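/- **Theorem 4.1.** Let $\Bbbk$ be a field. A *trident system* (trident algebra) $(A,M,f,g)$ over $\Bbbk$ consists of a unital associative algebra $A=\Bbbk 1_A\oplus\bar A$ augmented by an algebra homomorphism $\varepsilon\colon A\to\Bbbk$ with augmentation ideal $\bar A=\ker\varepsilon$; a nonzero left $A$-, right $A\otimes A$-bimodule $M$ with a right action of $\mathbb S_2=\{1,(12)\}$ such that $a(\mu*(12))=(a\mu)*(12)$ and $(\mu\cdot(a\otimes b))*(12)=(\mu*(12))\cdot(b\otimes a)$; a linear map $f\colon\bar A\to M$ with $f(a)*(12)=f(a)$; and a homomorphism of right $A\otimes A$-modules $g\colon\bar A\otimes\bar A\to M$ with $g(a,b)*(12)=g(b,a)$; such that for all $a,b,c\in\bar A$ $$f(ab)=af(b)+f(a)\cdot(b\otimes 1)+f(a)\cdot(1\otimes b)+g(a,b)+g(b,a),$$ $$f(a)\cdot(b\otimes c)=a\,g(b,c)-g(ab,c)-g(b,ac).$$ Assume that $A$ and $M$ are finite dimensional, put $d=\dim\bar A$, $m_0=\dim M$, and write $\mu\cdot_1b=\mu\cdot(b\otimes1)$, $\mu\cdot_2b=\mu\cdot(1\otimes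 b)$. For $n\ge0$ let $$\mathcal P(n)=\Bbbk 1_n\oplus\bigoplus_{k=1}^n\bar A^{(n)}_k\oplus\bigoplus_{1\le i<j\le n}M^{(n)}_{ij},$$ with isomorphisms $\varphi^{(n)}_k\colon\bar A\to\bar A^{(n)}_k$ and $\psi^{(n)}_{ij}\colon M\to M^{(n)}_{ij}$ (so $\mathcal P(0)=\Bbbk1_0$ and $\mathcal P(1)=\Bbbk 1_1\oplus\bar A$ is identified with $A$). Let $\sigma\in\mathbb S_n$ act on the right on $\mathcal P(n)$ linearly by $1_n*\sigma=1_n$, $\varphi^{(n)}_i(a)*\sigma=\varphi^{(n)}_{\sigma^{-1}(i)}(a)$, and $\psi^{(n)}_{ij}(\mu)*\sigma=\psi^{(n)}_{\sigma^{-1}(i),\sigma^{-1}(j)}(\mu)$ if $\sigma^{-1}(i)<\sigma^{-1}(j)$, $\psi^{(n)}_{ij}(\mu)*\sigma=\psi^{(n)}_{\sigma^{-1}(j),\sigma^{-1}(i)}(\mu*(12))$ otherwise. Define bilinear partial compositions $\circ_s\colon\mathcal P(m)\times\mathcal P(n)\to\mathcal P(p)$, $m\ge1$, $n\ge0$, $1\le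 s\le m$, $p=m+n-1$, by * $1_m\circ_s1_n=1_p$, $\ 1_m\circ_s\varphi^{(n)}_i(a)=\varphi^{(p)}_{s+i-1}(a)$, $\ 1_m\circ_s\psi^{(n)}_{ij}(\mu)=\psi^{(p)}_{s+i-1,s+j-1}(\mu)$; * $\varphi^{(m)}_i(a)\circ_s1_n=\varphi^{(p)}_i(a)$ if $i<s$; $\ \sum_{k=i}^{i+n-1}\varphi^{(p)}_k(a)+\sum_{i\le k_1<k_2\le i+n-1}\psi^{(p)}_{k_1k_2}(f(a))$ if $i=s$; $\ \varphi^{(p)}_{i+n-1}(a)$ if $i>s$; * $\varphi^{(m)}_i(a)\circ_s\varphi^{(n)}_j(b)=\psi^{(p)}_{i,s+j-1}(g(a,b))$ if $i<s$; $\ \psi^{(p)}_{s+j-1,i+n-1}(g(b,a))$ if $i>s$; and, if $i=s$, $$\sum_{k=i}^{i+j-2}\psi^{(p)}_{k,i+j-1}\bigl(g(a,b)+f(a)\cdot_2b\bigr)+\varphi^{(p)}_{i+j-1}(ab)+\sum_{k=i+j}^{i+n-1}\psi^{(p)}_{i+j-1,k}\bigl(g(b,a)+f(a)\cdot_1b\bigr);$$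 * $\varphi^{(m)}_i(a)\circ_s\psi^{(n)}_{j_1j_2}(\mu)=\psi^{(p)}_{i+j_1-1,i+j_2-1}(a\mu)$ if $i=s$, and $0$ if $i\ne s$; * $\psi^{(m)}_{i_1i_2}(\mu)\circ_s1_n=\psi^{(p)}_{i_1+n-1,i_2+n-1}(\mu)$ if $s<i_1$; $\ \sum_{k=i_1}^{i_1+n-1}\psi^{(p)}_{k,i_2+n-1}(\mu)$ if $s=i_1$; $\ \psi^{(p)}_{i_1,i_2+n-1}(\mu)$ if $i_1<s<i_2$; $\ \sum_{k=i_2}^{i_2+n-1}\psi^{(p)}_{i_1,k}(\mu)$ if $s=i_2$; $\ \psi^{(p)}_{i_1i_2}(\mu)$ if $s>i_2$; * $\psi^{(m)}_{i_1i_2}(\mu)\circ_s\varphi^{(n)}_j(b)=\psi^{(p)}_{i_1+j-1,i_2+n-1}(\mu\cdot_1b)$ if $s=i_1$; $\ \psi^{(p)}_{i_1,i_2+j-1}(\mu\cdot_2b)$ if $s=i_2$; $\ 0$ otherwise; * $\psi^{(m)}_{i_1i_2}(\mu)\circ_s\psi^{(n)}_{j_1j_2}(\nu)=0$. Then $\mathcal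 P=F(A,M,f,g)$, with identity $1_1$, is a (symmetric, $\Bbbk$-linear) operad. It is 2-unitary with 0-unit $1_0$ and 2-unit $1_2$, that is, $1_0$ is a basis of $\mathcal P(0)$ and $1_2\circ_1 1_0=1_1=1_2\circ_2 1_0$. It is $\mathrm{Com}$-augmented: the maps $\mathrm{Com}(n)=\Bbbk 1_n\to\mathcal P(n)$, $1_n\mapsto 1_n$, form a morphism of operads. Every $\mathcal P(n)$ is finite dimensional, the Gelfand–Kirillov dimension is $$\limsup_{n\to\infty}\log_n\Bigl(\sum_{i=0}^n\dim\mathcal P(i)\Bigr)=3,$$ and the generating series is $$\sum_{n\ge0}\dim\mathcal P(n)\,t^n=\frac1{1-t}+d\,\frac t{(1-t)^2}+m_0\,\frac{t^2}{(1-t)^3}\quad\text{in }\mathbb Z[[t]].$$ -/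

import Mathlib

open scoped TensorProduct

namespace TridentOperad

universe u v w x

/-! ### Partial composition of permutations -/

/-- Inserting a block of `n` consecutive letters in place of the letter `i` of `{0, …, m - 1}`
produces `p = m + n - 1` letters: a letter of the result is either (the shift of) an old letter
`j ≠ i`, or the `t`-th letter of the inserted block, which has number `i + t`. -/
def blockEquiv {m n p : ℕ} (h : p + 1 = m + n) (i : Fin m) :
    Fin p ≃ {j : Fin m // j ≠ i} ⊕ Fin n where
  toFun y :=
    if h1 : (y : ℕ) < i then
      Sum.inl ⟨⟨y, by omega⟩, fun e => by rw [Fin.ext_iff] at e; simp only at e; omega⟩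
    else if h2 : (y : ℕ) < i + n then Sum.inr ⟨y - i, by omega⟩
    else Sum.inl ⟨⟨y + 1 - n, by omega⟩, fun e => by rw [Fin.ext_iff] at e; simp only at e; omega⟩
  invFun z := match z with
    | Sum.inl j =>
        if h1 : (j.1 : ℕ) < i then ⟨j.1, by omega⟩
        else ⟨j.1 + n - 1, by
          have h2 := j.2
          rw [ne_eq, Fin.ext_iff] at h2
          omega⟩
    | Sum.inr t => ⟨i + t, by omega⟩
  left_inv y := by
    dsimp only
    split_ifs with h1 h2
    · simp [h1]
    · ext; simp; omega
    · have h3 : ¬ ((y : ℕ) + 1 - n < i) := by omega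
      ext; simp [h3]; omega
  right_inv z := by
    rcases z with ⟨j, hj⟩ | t
    · rw [ne_eq, Fin.ext_iff] at hj
      dsimp only
      split_ifs with h1 h2 h3
      · rfl
      all_goals first
        | (exfalso; simp only at *; omega)
        | (congr 2; ext; simp only; omega)
    · have h1 : ¬ ((i : ℕ) + t < i) := by omega
      have h2 : (i : ℕ) + t < i + n := by omega
      simp

/-- The partial composition `σ ∘ᵢ τ` of the associative algebra operad, on permutations.
If `σ` is regarded as the word in which the letter `j` stands at the position `σ j`, then
`σ ∘ᵢ τ` is obtained from `σ` by replacing the letter `i` with the word `τ` in the letters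
`i, …, i + n - 1` (and renumbering the later letters). -/
def permComp {m n p : ℕ} (h : p + 1 = m + n) (i : Fin m)
    (σ : Equiv.Perm (Fin m)) (τ : Equiv.Perm (Fin n)) : Equiv.Perm (Fin p) :=
  (blockEquiv h i).trans
    ((Equiv.sumCongr (σ.subtypeEquiv (fun j => by simp)) τ).trans (blockEquiv h (σ i)).symm)

/-! ### Operads (partial definition) -/

/-- The data of a `k`-linear symmetric operad in terms of partial compositions, before any axiom
(linearity of the actions and bilinearity of the compositions are among the axioms below):
vector spaces `P(n)`, the right actions `μ ∗ σ` (written `act σ μ`), the identity in `P(1)` and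
the partial compositions `P(m) × P(n) → P(p)`, where `p = m + n - 1`. The slots of an
`m`-ary operation are numbered by `Fin m`, that is by `0, …, m - 1`; in particular
partial compositions exist only for `m ≥ 1`. -/
structure OperadData (k : Type u) [Field k] where
  obj : ℕ → Type v
  [addCommGroup : ∀ n, AddCommGroup (obj n)]
  [module : ∀ n, Module k (obj n)]
  act : ∀ {n : ℕ}, Equiv.Perm (Fin n) → obj n → obj n
  id : obj 1
  comp : ∀ {m n p : ℕ}, p + 1 = m + n → Fin m → obj m → obj n → obj p

attribute [instance] OperadData.addCommGroup OperadData.module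

namespace OperadData

variable {k : Type u} [Field k]

/-- The axioms of an operad. -/
structure IsOperad (P : OperadData.{u, v} k) : Prop where
  /-- the actions are linear and the partial compositions are bilinear -/
  act_add : ∀ {n : ℕ} (σ : Equiv.Perm (Fin n)) (μ ν : P.obj n),
    P.act σ (μ + ν) = P.act σ μ + P.act σ ν
  act_smul : ∀ {n : ℕ} (σ : Equiv.Perm (Fin n)) (c : k) (μ : P.obj n),
    P.act σ (c • μ) = c • P.act σ μ
  add_comp : ∀ {m n p : ℕ} (h : p + 1 = m + n) (i : Fin m) (lam μ : P.obj m) (ν : P.obj n),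
    P.comp h i (lam + μ) ν = P.comp h i lam ν + P.comp h i μ ν
  smul_comp : ∀ {m n p : ℕ} (h : p + 1 = m + n) (i : Fin m) (c : k) (μ : P.obj m)
    (ν : P.obj n), P.comp h i (c • μ) ν = c • P.comp h i μ ν
  comp_add : ∀ {m n p : ℕ} (h : p + 1 = m + n) (i : Fin m) (lam : P.obj m) (μ ν : P.obj n),
    P.comp h i lam (μ + ν) = P.comp h i lam μ + P.comp h i lam ν
  comp_smul : ∀ {m n p : ℕ} (h : p + 1 = m + n) (i : Fin m) (c : k) (μ : P.obj m)
    (ν : P.obj n), P.comp h i μ (c • ν) = c • P.comp h i μ ν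
  /-- `act` is a right action of the symmetric group -/
  act_one : ∀ {n : ℕ} (μ : P.obj n), P.act 1 μ = μ
  act_mul : ∀ {n : ℕ} (σ τ : Equiv.Perm (Fin n)) (μ : P.obj n),
    P.act (σ * τ) μ = P.act τ (P.act σ μ)
  /-- identity -/
  comp_id : ∀ {m : ℕ} (i : Fin m) (μ : P.obj m), P.comp rfl i μ P.id = μ
  id_comp : ∀ {m : ℕ} (h : m + 1 = 1 + m) (μ : P.obj m), P.comp h 0 P.id μ = μ
  /-- sequential associativity: `(lam ∘ᵢ μ) ∘ᵢ₊ⱼ ν = lam ∘ᵢ (μ ∘ⱼ ν)`, slots counted from zero -/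
  assoc_seq : ∀ {l m n a b p : ℕ} (h₁ : a + 1 = l + m) (h₂ : p + 1 = a + n)
    (h₃ : b + 1 = m + n) (h₄ : p + 1 = l + b) (i : Fin l) (j : Fin m) (s : Fin a),
    (s : ℕ) = i + j → ∀ (lam : P.obj l) (μ : P.obj m) (ν : P.obj n),
      P.comp h₂ s (P.comp h₁ i lam μ) ν = P.comp h₄ i lam (P.comp h₃ j μ ν)
  /-- parallel associativity: `(lam ∘ᵢ μ) ∘ₛ ν = (lam ∘ⱼ ν) ∘ᵢ μ` for `i < j`, with
  `s = j + m - 1` -/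
  assoc_par : ∀ {l m n a b p : ℕ} (h₁ : a + 1 = l + m) (h₂ : p + 1 = a + n)
    (h₃ : b + 1 = l + n) (h₄ : p + 1 = b + m) (i j : Fin l) (s : Fin a) (r : Fin b),
    i < j → (s : ℕ) + 1 = j + m → (r : ℕ) = i →
    ∀ (lam : P.obj l) (μ : P.obj m) (ν : P.obj n),
      P.comp h₂ s (P.comp h₁ i lam μ) ν = P.comp h₄ r (P.comp h₃ j lam ν) μ
  /-- equivariance in the second argument -/
  comp_act : ∀ {m n p : ℕ} (h : p + 1 = m + n) (i : Fin m) (σ : Equiv.Perm (Fin n))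
    (μ : P.obj m) (ν : P.obj n),
      P.comp h i μ (P.act σ ν) = P.act (permComp h i 1 σ) (P.comp h i μ ν)
  /-- equivariance in the first argument -/
  act_comp : ∀ {m n p : ℕ} (h : p + 1 = m + n) (i : Fin m) (ρ : Equiv.Perm (Fin m))
    (μ : P.obj m) (ν : P.obj n),
      P.comp h i (P.act ρ μ) ν = P.act (permComp h i ρ 1) (P.comp h (ρ i) μ ν)

/-- `e₀` is a 0-unit: it is a basis of the space `P(0)`. -/
def IsZeroUnit (P : OperadData.{u, v} k) (e₀ : P.obj 0) : Prop :=
  e₀ ≠ 0 ∧ ∀ y : P.obj 0, ∃ c : k, y = c • e₀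

/-- `P` is 2-unitary with the 0-unit `e₀` and the 2-unit `e₂`. -/
def IsTwoUnitary (P : OperadData.{u, v} k) (e₀ : P.obj 0) (e₂ : P.obj 2) : Prop :=
  P.IsZeroUnit e₀ ∧ P.comp (m := 2) (n := 0) (p := 1) rfl 0 e₂ e₀ = P.id ∧
    P.comp (m := 2) (n := 0) (p := 1) rfl 1 e₂ e₀ = P.id

/-- Every `P(n)` is finite dimensional. -/
def IsLocallyFinite (P : OperadData.{u, v} k) : Prop :=
  ∀ n, Module.Finite k (P.obj n)

/-- The generating series `∑ dim P(n) tⁿ`. -/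
noncomputable def genSeries (P : OperadData.{u, v} k) : PowerSeries ℤ :=
  PowerSeries.mk fun n => (Module.finrank k (P.obj n) : ℤ)

/-- The Gelfand-Kirillov dimension `limsup log_n (∑_{i ≤ n} dim P(i))`, in `[-∞, ∞]`. -/
noncomputable def gkDim (P : OperadData.{u, v} k) : EReal :=
  Filter.limsup
    (fun n : ℕ => ((Real.logb (n : ℝ)
      (∑ i ∈ Finset.range (n + 1), (Module.finrank k (P.obj i) : ℝ)) : ℝ) : EReal))
    Filter.atTop

/-- Morphisms of operads. -/
structure Hom (P : OperadData.{u, v} k) (Q : OperadData.{u, w} k) where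
  app : ∀ n : ℕ, P.obj n →ₗ[k] Q.obj n
  map_act : ∀ {n : ℕ} (σ : Equiv.Perm (Fin n)) (μ : P.obj n),
    app n (P.act σ μ) = Q.act σ (app n μ)
  map_id : app 1 P.id = Q.id
  map_comp : ∀ {m n p : ℕ} (h : p + 1 = m + n) (i : Fin m) (μ : P.obj m) (ν : P.obj n),
    app p (P.comp h i μ ν) = Q.comp h i (app m μ) (app n ν)

/-- The operad `Com` of unital commutative algebras: `Com(n) = k`, with basis `1ₙ = 1`, the
trivial actions, and `1ₘ ∘ᵢ 1ₙ = 1ₘ₊ₙ₋₁`. -/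
def com (k : Type u) [Field k] : OperadData.{u, u} k where
  obj _ := k
  act _ y := y
  id := (1 : k)
  comp _ _ y z := (y * z : k)

theorem com_isOperad (k : Type u) [Field k] : (com k).IsOperad where
  act_add _ _ _ := rfl
  act_smul _ _ _ := rfl
  add_comp _ _ lam μ ν := add_mul (R := k) lam μ ν
  smul_comp _ _ c μ ν := mul_assoc (G := k) c μ ν
  comp_add _ _ lam μ ν := mul_add (R := k) lam μ ν
  comp_smul _ _ c μ ν := mul_left_comm (G := k) μ c ν
  act_one _ := rfl
  act_mul _ _ _ := rfl
  comp_id _ μ := mul_one (M := k) μ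
  id_comp _ μ := one_mul (M := k) μ
  assoc_seq _ _ _ _ _ _ _ _ lam μ ν := mul_assoc (G := k) lam μ ν
  assoc_par _ _ _ _ _ _ _ _ _ _ _ lam μ ν := mul_right_comm (G := k) lam μ ν
  comp_act _ _ _ _ _ := rfl
  act_comp _ _ _ _ _ := rfl

end OperadData

/-! ### Trident systems -/

section

variable {k : Type u} {A : Type v} [Field k] [Ring A] [Algebra k A]

/-- The augmentation ideal of the algebra `A` augmented by `ε`. -/
def augIdeal (ε : A →ₐ[k] k) : Submodule k A := LinearMap.ker ε.toLinearMap

/-- The right action of `A` on its augmentation ideal, `(a, b) ↦ a b`. -/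
def augMul {ε : A →ₐ[k] k} (a : augIdeal ε) (b : A) : augIdeal ε :=
  ⟨a * b, by
    have ha : ε (a : A) = 0 := a.2
    change ε ((a : A) * b) = 0
    rw [map_mul, ha, zero_mul]⟩

end

/-- A trident system `(A, M, f, g)` over `k`. Here `A` is an algebra with augmentation `ε`, and
`M` is a left `A`-, right `A ⊗ A`-bimodule, with a right action of the symmetric group of order
two, given by the involution `swap`. A right module over `A ⊗ A` is a module
over its opposite: `μ · (a ⊗ b)` is written `MulOpposite.op (a ⊗ₜ b) • μ`. -/
structure TridentSystem (k : Type u) (A : Type v) (M : Type w) [Field k] [Ring A] [Algebra k A]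
    [AddCommGroup M] [Module k M] [Module A M] [IsScalarTower k A M]
    [Module (A ⊗[k] A)ᵐᵒᵖ M] [IsScalarTower k (A ⊗[k] A)ᵐᵒᵖ M]
    [SMulCommClass A (A ⊗[k] A)ᵐᵒᵖ M] where
  ε : A →ₐ[k] k
  swap : M →ₗ[k] M
  swap_swap : ∀ μ, swap (swap μ) = μ
  swap_smul : ∀ (a : A) (μ : M), swap (a • μ) = a • swap μ
  swap_op_smul : ∀ (a b : A) (μ : M),
    swap (MulOpposite.op (a ⊗ₜ[k] b) • μ) = MulOpposite.op (b ⊗ₜ[k] a) • swap μ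
  f : augIdeal ε →ₗ[k] M
  swap_f : ∀ a, swap (f a) = f a
  g : augIdeal ε →ₗ[k] augIdeal ε →ₗ[k] M
  swap_g : ∀ a b, swap (g a b) = g b a
  /-- `g` is a homomorphism of right `A ⊗ A`-modules -/
  g_augMul : ∀ (a b : augIdeal ε) (c d : A),
    g (augMul a c) (augMul b d) = MulOpposite.op (c ⊗ₜ[k] d) • g a b
  f_mul : ∀ a b : augIdeal ε, f (augMul a b) =
    (a : A) • f b + MulOpposite.op ((b : A) ⊗ₜ[k] (1 : A)) • f a
      + MulOpposite.op ((1 : A) ⊗ₜ[k] (b : A)) • f a + g a b + g b a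
  f_smul : ∀ a b c : augIdeal ε, MulOpposite.op ((b : A) ⊗ₜ[k] (c : A)) • f a =
    (a : A) • g b c - g (augMul a b) c - g b (augMul a c)

/-! ### The operad of a trident system -/

namespace TridentSystem

variable {k : Type u} {A : Type v} {M : Type w} [Field k] [Ring A] [Algebra k A]
  [AddCommGroup M] [Module k M] [Module A M] [IsScalarTower k A M]
  [Module (A ⊗[k] A)ᵐᵒᵖ M] [IsScalarTower k (A ⊗[k] A)ᵐᵒᵖ M]
  [SMulCommClass A (A ⊗[k] A)ᵐᵒᵖ M] (T : TridentSystem k A M)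

/-- Pairs `i < j` of slots. -/
abbrev Pairs (n : ℕ) : Type := {q : Fin n × Fin n // q.1 < q.2}

/-- The augmentation ideal of the algebra `A`. -/
abbrev bar : Type v := augIdeal T.ε

/-- The space `P(n)`: the direct sum of the line spanned by `1ₙ`, of one copy of the augmentation
ideal for each slot, and of one copy of `M` for each pair of slots `i < j`. -/
abbrev space (n : ℕ) : Type (max u v w) := k × (Fin n → T.bar) × (Pairs n → M)

/-- The element `1ₙ` of `P(n)`. -/
def unit (n : ℕ) : T.space n := (1, 0, 0)

/-- The element `φᵢ(a)` of the copy of the augmentation ideal with index `i`, slots counted from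
zero. The index is a natural number for convenience, and is below `n` in every use. -/
def phi (n i : ℕ) (a : T.bar) : T.space n :=
  (0, fun r => if (r : ℕ) = i then a else 0, 0)

/-- The element `ψᵢⱼ(μ)` of the copy of `M` with index `i < j`, slots counted from zero.
The indices are natural numbers for convenience, and `i < j < n` in every use. -/
def psi (n i j : ℕ) (μ : M) : T.space n :=
  (0, 0, fun q => if (q.1.1 : ℕ) = i ∧ (q.1.2 : ℕ) = j then μ else 0)

/-- `ψᵢⱼ(μ) ∗ σ` -/
def psiAct {n : ℕ} (σ : Equiv.Perm (Fin n)) (i j : Fin n) (μ : M) : T.space n :=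
  if σ⁻¹ i < σ⁻¹ j then T.psi n (σ⁻¹ i : Fin n) (σ⁻¹ j : Fin n) μ
  else T.psi n (σ⁻¹ j : Fin n) (σ⁻¹ i : Fin n) (T.swap μ)

/-- `φᵢ(a) ∘ₛ 1ₙ` in `P(p)` -/
def phiUnit (n p s i : ℕ) (a : T.bar) : T.space p :=
  if i < s then T.phi p i a
  else if i = s then
    ∑ r ∈ Finset.Ico i (i + n), T.phi p r a
      + ∑ r₁ ∈ Finset.Ico i (i + n), ∑ r₂ ∈ Finset.Ico (r₁ + 1) (i + n), T.psi p r₁ r₂ (T.f a)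
  else T.phi p (i + n - 1) a

/-- `φᵢ(a) ∘ₛ φⱼ(b)` in `P(p)`, for `φⱼ(b)` in `P(n)` -/
def phiPhi (n p s i j : ℕ) (a b : T.bar) : T.space p :=
  if i < s then T.psi p i (s + j) (T.g a b)
  else if i = s then
    ∑ r ∈ Finset.Ico i (i + j),
          T.psi p r (i + j) (T.g a b + MulOpposite.op ((1 : A) ⊗ₜ[k] (b : A)) • T.f a)
      + T.phi p (i + j) (augMul a (b : A))
      + ∑ r ∈ Finset.Ico (i + j + 1) (i + n),
          T.psi p (i + j) r (T.g b a + MulOpposite.op ((b : A) ⊗ₜ[k] (1 : A)) • T.f a)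
  else T.psi p (s + j) (i + n - 1) (T.g b a)

/-- `φᵢ(a) ∘ₛ ψ_{j₁j₂}(μ)` in `P(p)` -/
def phiPsi (p s i j₁ j₂ : ℕ) (a : T.bar) (μ : M) : T.space p :=
  if i = s then T.psi p (i + j₁) (i + j₂) ((a : A) • μ) else 0

/-- `ψ_{i₁i₂}(μ) ∘ₛ 1ₙ` in `P(p)` -/
def psiUnit (n p s i₁ i₂ : ℕ) (μ : M) : T.space p :=
  if s < i₁ then T.psi p (i₁ + n - 1) (i₂ + n - 1) μ
  else if s = i₁ then ∑ r ∈ Finset.Ico i₁ (i₁ + n), T.psi p r (i₂ + n - 1) μ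
  else if s < i₂ then T.psi p i₁ (i₂ + n - 1) μ
  else if s = i₂ then ∑ r ∈ Finset.Ico i₂ (i₂ + n), T.psi p i₁ r μ
  else T.psi p i₁ i₂ μ

/-- `ψ_{i₁i₂}(μ) ∘ₛ φⱼ(b)` in `P(p)`, for `φⱼ(b)` in `P(n)` -/
def psiPhi (n p s i₁ i₂ j : ℕ) (μ : M) (b : T.bar) : T.space p :=
  if s = i₁ then T.psi p (i₁ + j) (i₂ + n - 1) (MulOpposite.op ((b : A) ⊗ₜ[k] (1 : A)) • μ)
  else if s = i₂ then T.psi p i₁ (i₂ + j) (MulOpposite.op ((1 : A) ⊗ₜ[k] (b : A)) • μ)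
  else 0

/-- The right action of the symmetric group on `P(n)`: the linear extension of
`1ₙ ∗ σ = 1ₙ`, `φᵢ(a) ∗ σ = φ_{σ⁻¹ i}(a)` and `psiAct`. -/
def actFun {n : ℕ} (σ : Equiv.Perm (Fin n)) (y : T.space n) : T.space n :=
  y.1 • T.unit n
    + ∑ i, T.phi n (σ⁻¹ i : Fin n) (y.2.1 i)
    + ∑ q : Pairs n, T.psiAct σ q.1.1 q.1.2 (y.2.2 q)

/-- The partial composition `y ∘ₛ z` in `P(p)`: the bilinear extension of
`1ₘ ∘ₛ 1ₙ = 1ₚ`, `1ₘ ∘ₛ φⱼ(b) = φ_{s+j}(b)`, `1ₘ ∘ₛ ψ_{j₁j₂}(μ) = ψ_{s+j₁,s+j₂}(μ)`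
(slots counted from zero), of `phiUnit`, `phiPhi`, `phiPsi`, `psiUnit`, `psiPhi`, and of
`ψ_{i₁i₂}(μ) ∘ₛ ψ_{j₁j₂}(ν) = 0`. -/
def compFun {m n : ℕ} (p : ℕ) (s : Fin m) (y : T.space m) (z : T.space n) : T.space p :=
  (y.1 * z.1) • T.unit p
    + y.1 • ∑ j : Fin n, T.phi p (s + j) (z.2.1 j)
    + y.1 • ∑ q : Pairs n, T.psi p (s + q.1.1) (s + q.1.2) (z.2.2 q)
    + z.1 • ∑ i : Fin m, T.phiUnit n p s i (y.2.1 i)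
    + ∑ i : Fin m, ∑ j : Fin n, T.phiPhi n p s i j (y.2.1 i) (z.2.1 j)
    + ∑ i : Fin m, ∑ q : Pairs n, T.phiPsi p s i q.1.1 q.1.2 (y.2.1 i) (z.2.2 q)
    + z.1 • ∑ q : Pairs m, T.psiUnit n p s q.1.1 q.1.2 (y.2.2 q)
    + ∑ q : Pairs m, ∑ j : Fin n, T.psiPhi n p s q.1.1 q.1.2 j (y.2.2 q) (z.2.1 j)

/-- The operad `F(A, M, f, g)` of a trident system (that it satisfies the axioms of an operad is
not part of this definition). -/
def operad : OperadData.{u, max u v w} k where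
  obj := T.space
  act := T.actFun
  id := T.unit 1
  comp {_ _ p} _ s := T.compFun p s

end TridentSystem

end TridentOperad

/-! An element y of P(n) consists of a constant y₀, slot components yᵢ in the augmentation ideal,
and pair components yᵢⱼ in M for i < j. Setting yⱼᵢ = yᵢⱼ * (12) (`coef`) removes the order of the
slots from every formula. The symmetric group then merely permutes indices (`act_slot`, `act_coef`),
and the many cases defining y ∘ₛ z reduce to whether a slot of the result is an old slot i, j ≠ s or
a slot t, u of the inserted block: constant: y₀z₀; slot i: z₀yᵢ; slot t: z₀yₛ + y₀zₜ + yₛzₜ; pair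
ij: z₀yᵢⱼ; pair it: z₀yᵢₛ + yᵢₛ·₂zₜ + g(yᵢ, zₜ); pair tu: y₀zₜᵤ + yₛzₜᵤ + z₀f(yₛ) + f(yₛ)·₁zₜ +
f(yₛ)·₂zᵤ + g(yₛ, zᵤ) + g(zₜ, yₛ).

Bilinearity, the identity and equivariance can be read off. Associativity is compared coordinate by
coordinate. The parallel law (`comp_comp_par`) needs only the bimodule axioms and the A ⊗
A-linearity of g; the sequential law (`comp_comp_seq`) is where the two identities relating f and g
enter.

For the numerical claims, dim P(n) = 1 + nd + C(n,2)m₀. Its partial sums are asymptotic to m₀n³/6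
with m₀ > 0, which gives exponent 3, and the binomial series for (1 - t)⁻¹, (1 - t)⁻² and (1 - t)⁻³
give the generating series. -/

namespace TridentOperad

set_option linter.unusedSectionVars false
set_option linter.unnecessarySeqFocus false

universe u v w

/-! ### Positions of slots after inserting a block -/

section Block

variable {m n p : ℕ}

/-- The position of the old letter `j ≠ i` after a block has been inserted at `i`. -/
def blockOut (h : p + 1 = m + n) (i : Fin m) (j : {j : Fin m // j ≠ i}) : Fin p :=
  (blockEquiv h i).symm (Sum.inl j)

/-- The position of the `t`-th letter of a block inserted at `i`. -/
def blockIn (h : p + 1 = m + n) (i : Fin m) (t : Fin n) : Fin p :=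
  (blockEquiv h i).symm (Sum.inr t)

/-- In the second case j > i, so the subtraction is not truncated even for n = 0. -/
theorem blockOut_val (h : p + 1 = m + n) (i : Fin m) (j : {j : Fin m // j ≠ i}) :
    (blockOut h i j : ℕ) = if (j.1 : ℕ) < i then (j.1 : ℕ) else j.1 + n - 1 := by
  simp only [blockOut, blockEquiv, Equiv.coe_fn_symm_mk]
  split_ifs <;> rfl

theorem blockIn_val (h : p + 1 = m + n) (i : Fin m) (t : Fin n) :
    (blockIn h i t : ℕ) = i + t := rfl

theorem block_cases (h : p + 1 = m + n) (i : Fin m) (r : Fin p) :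
    (∃ j, r = blockOut h i j) ∨ ∃ t, r = blockIn h i t := by
  obtain ⟨z, rfl⟩ := (blockEquiv h i).symm.surjective r
  rcases z with j | t
  · exact Or.inl ⟨j, rfl⟩
  · exact Or.inr ⟨t, rfl⟩

theorem blockOut_ne_blockIn (h : p + 1 = m + n) (i : Fin m) (j : {j : Fin m // j ≠ i})
    (t : Fin n) : blockOut h i j ≠ blockIn h i t :=
  fun e => by simpa using (blockEquiv h i).symm.injective e

theorem blockOut_injective (h : p + 1 = m + n) (i : Fin m) :
    Function.Injective (blockOut h i) :=
  fun _ _ e => Sum.inl_injective ((blockEquiv h i).symm.injective e)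

theorem blockIn_injective (h : p + 1 = m + n) (i : Fin m) :
    Function.Injective (blockIn h i) :=
  fun _ _ e => Sum.inr_injective ((blockEquiv h i).symm.injective e)

/-- Together with `permComp_blockIn`, this is all that the equivariance axioms need to know about
`permComp`. -/
theorem permComp_blockOut (h : p + 1 = m + n) (i : Fin m) (σ : Equiv.Perm (Fin m))
    (τ : Equiv.Perm (Fin n)) (j : {j : Fin m // j ≠ i}) :
    permComp h i σ τ (blockOut h i j) =
      blockOut h (σ i) ⟨σ j, fun e => j.2 (σ.injective e)⟩ := by
  simp [permComp, blockOut]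

theorem permComp_blockIn (h : p + 1 = m + n) (i : Fin m) (σ : Equiv.Perm (Fin m))
    (τ : Equiv.Perm (Fin n)) (t : Fin n) :
    permComp h i σ τ (blockIn h i t) = blockIn h (σ i) (τ t) := by
  simp [permComp, blockIn]

/-- The three kinds of positions after inserting a block into an inserted block. -/
theorem block_cases_seq {l m n a b p : ℕ} (h₁ : a + 1 = l + m) (h₂ : p + 1 = a + n)
    (h₃ : b + 1 = m + n) (h₄ : p + 1 = l + b) (i : Fin l) (j : Fin m) (r : Fin p) :
    (∃ (x : {x // x ≠ i}), r = blockOut h₄ i x ∧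
      r = blockOut h₂ (blockIn h₁ i j) ⟨blockOut h₁ i x, blockOut_ne_blockIn h₁ i x j⟩) ∨
    (∃ (t : {t // t ≠ j}), r = blockIn h₄ i (blockOut h₃ j t) ∧
      r = blockOut h₂ (blockIn h₁ i j)
        ⟨blockIn h₁ i t, fun e => t.2 (blockIn_injective h₁ i e)⟩) ∨
    (∃ t, r = blockIn h₄ i (blockIn h₃ j t) ∧ r = blockIn h₂ (blockIn h₁ i j) t) := by
  rcases block_cases h₄ i r with ⟨x, rfl⟩ | ⟨t, rfl⟩
  · refine Or.inl ⟨x, rfl, Fin.ext ?_⟩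
    have hx : (x.1 : ℕ) ≠ i := fun e => x.2 (Fin.ext e)
    simp only [blockOut_val, blockIn_val]
    split_ifs <;> omega
  · rcases block_cases h₃ j t with ⟨t, rfl⟩ | ⟨t, rfl⟩
    · refine Or.inr (Or.inl ⟨t, rfl, Fin.ext ?_⟩)
      have hx : (t.1 : ℕ) ≠ j := fun e => t.2 (Fin.ext e)
      by_cases hlt : (t.1 : ℕ) < j <;> simp [blockOut_val, blockIn_val, hlt] <;> omega
    · refine Or.inr (Or.inr ⟨t, rfl, Fin.ext ?_⟩)
      simp only [blockIn_val]
      omega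

/-- The three kinds of positions after inserting two blocks in parallel. -/
theorem block_cases_par {l m n a b p : ℕ} (h₁ : a + 1 = l + m) (h₂ : p + 1 = a + n)
    (h₃ : b + 1 = l + n) (h₄ : p + 1 = b + m) (i j : Fin l) (hij : i < j) (r : Fin p) :
    (∃ (x : Fin l) (hi : x ≠ i) (hj : x ≠ j),
      r = blockOut h₂ (blockOut h₁ i ⟨j, hij.ne'⟩) ⟨blockOut h₁ i ⟨x, hi⟩,
        fun e => hj (congrArg Subtype.val (blockOut_injective h₁ i e))⟩ ∧
      r = blockOut h₄ (blockOut h₃ j ⟨i, hij.ne⟩) ⟨blockOut h₃ j ⟨x, hj⟩,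
        fun e => hi (congrArg Subtype.val (blockOut_injective h₃ j e))⟩) ∨
    (∃ t, r = blockOut h₂ (blockOut h₁ i ⟨j, hij.ne'⟩)
        ⟨blockIn h₁ i t, (blockOut_ne_blockIn h₁ i _ t).symm⟩ ∧
      r = blockIn h₄ (blockOut h₃ j ⟨i, hij.ne⟩) t) ∨
    (∃ t, r = blockIn h₂ (blockOut h₁ i ⟨j, hij.ne'⟩) t ∧
      r = blockOut h₄ (blockOut h₃ j ⟨i, hij.ne⟩)
        ⟨blockIn h₃ j t, (blockOut_ne_blockIn h₃ j _ t).symm⟩) := by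
  have hij' : (i : ℕ) < j := hij
  rcases block_cases h₂ (blockOut h₁ i ⟨j, hij.ne'⟩) r with ⟨⟨x, hx⟩, rfl⟩ | ⟨t, rfl⟩
  · rcases block_cases h₁ i x with ⟨⟨x, hi⟩, rfl⟩ | ⟨t, rfl⟩
    · have hj : x ≠ j := by rintro rfl; exact hx rfl
      refine Or.inl ⟨x, hi, hj, rfl, Fin.ext ?_⟩
      have hi' : (x : ℕ) ≠ i := fun e => hi (Fin.ext e)
      have hj' : (x : ℕ) ≠ j := fun e => hj (Fin.ext e)
      simp only [blockOut_val]
      split_ifs <;> omega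
    · refine Or.inr (Or.inl ⟨t, rfl, Fin.ext ?_⟩)
      simp only [blockOut_val, blockIn_val]
      split_ifs <;> omega
  · refine Or.inr (Or.inr ⟨t, rfl, Fin.ext ?_⟩)
    simp only [blockOut_val, blockIn_val]
    split_ifs <;> omega

end Block

namespace TridentSystem

variable {k : Type u} {A : Type v} {M : Type w} [Field k] [Ring A] [Algebra k A]
  [AddCommGroup M] [Module k M] [Module A M] [IsScalarTower k A M]
  [Module (A ⊗[k] A)ᵐᵒᵖ M] [IsScalarTower k (A ⊗[k] A)ᵐᵒᵖ M]
  [SMulCommClass A (A ⊗[k] A)ᵐᵒᵖ M] (T : TridentSystem k A M)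

/-! ### Bimodule calculus and the trident identities -/

section RightAction

variable (k)

/-- The right action `μ · (a ⊗ b)`. -/
def rmul (a b : A) (μ : M) : M := MulOpposite.op (a ⊗ₜ[k] b) • μ

theorem rmul_add (a b : A) (μ ν : M) : rmul k a b (μ + ν) = rmul k a b μ + rmul k a b ν :=
  smul_add _ _ _

theorem rmul_zero (a b : A) : rmul k a b (0 : M) = 0 := smul_zero _

theorem rmul_smul (a b : A) (c : k) (μ : M) : rmul k a b (c • μ) = c • rmul k a b μ :=
  smul_algebra_smul_comm c _ μ

/-- The left action `a μ`. -/
def lmul (a : A) (μ : M) : M := a • μ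

theorem lmul_add (a : A) (μ ν : M) : lmul a (μ + ν) = lmul a μ + lmul a ν := smul_add _ _ _

theorem lmul_smul (a : A) (c : k) (μ : M) : lmul a (c • μ) = c • lmul a μ :=
  smul_algebra_smul_comm c a μ

theorem add_lmul (a b : A) (μ : M) : lmul (a + b) μ = lmul a μ + lmul b μ := add_smul _ _ _

theorem smul_lmul (c : k) (a : A) (μ : M) : lmul (c • a) μ = c • lmul a μ := smul_assoc _ _ _

theorem mul_lmul (a b : A) (μ : M) : lmul (a * b) μ = lmul a (lmul b μ) := mul_smul _ _ _

theorem zero_lmul (μ : M) : lmul (0 : A) μ = 0 := zero_smul _ _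

theorem rmul_lmul (a b c : A) (μ : M) : rmul k a b (lmul c μ) = lmul c (rmul k a b μ) :=
  (smul_comm _ _ _).symm

theorem add_rmul (a a' b : A) (μ : M) :
    rmul k (a + a') b μ = rmul k a b μ + rmul k a' b μ := by
  simp only [rmul, TensorProduct.add_tmul, MulOpposite.op_add, add_smul]

theorem rmul_add_right (a b b' : A) (μ : M) :
    rmul k a (b + b') μ = rmul k a b μ + rmul k a b' μ := by
  simp only [rmul, TensorProduct.tmul_add, MulOpposite.op_add, add_smul]

theorem smul_rmul (c : k) (a b : A) (μ : M) : rmul k (c • a) b μ = c • rmul k a b μ := by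
  rw [rmul, ← TensorProduct.smul_tmul', MulOpposite.op_smul, smul_assoc]; rfl

theorem smul_rmul_right (c : k) (a b : A) (μ : M) : rmul k a (c • b) μ = c • rmul k a b μ := by
  rw [rmul, TensorProduct.tmul_smul, MulOpposite.op_smul, smul_assoc]; rfl

theorem rmul_zero_right (a : A) (μ : M) : rmul k a 0 μ = 0 := by
  simp [rmul]

/-- The factors c, d act first, so in a right action they stand on the left of the products. -/
theorem rmul_rmul (a b c d : A) (μ : M) :
    rmul k a b (rmul k c d μ) = rmul k (c * a) (d * b) μ := by
  simp only [rmul, smul_smul, ← MulOpposite.op_mul, Algebra.TensorProduct.tmul_mul_tmul]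

end RightAction

section AugMul

variable {ε : A →ₐ[k] k}

theorem coe_augMul (a : augIdeal ε) (b : A) : (augMul a b : A) = a * b := rfl

theorem augMul_one (a : augIdeal ε) : augMul a 1 = a := Subtype.ext (mul_one _)

theorem augMul_mul (a : augIdeal ε) (b c : A) : augMul a (b * c) = augMul (augMul a b) c :=
  Subtype.ext (mul_assoc _ _ _).symm

theorem augMul_add (a : augIdeal ε) (b c : A) : augMul a (b + c) = augMul a b + augMul a c :=
  Subtype.ext (mul_add _ _ _)

theorem add_augMul (a b : augIdeal ε) (c : A) : augMul (a + b) c = augMul a c + augMul b c :=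
  Subtype.ext (add_mul _ _ _)

theorem augMul_smul (c : k) (a : augIdeal ε) (b : A) : augMul a (c • b) = c • augMul a b :=
  Subtype.ext (mul_smul_comm _ _ _)

theorem smul_augMul (c : k) (a : augIdeal ε) (b : A) : augMul (c • a) b = c • augMul a b :=
  Subtype.ext (smul_mul_assoc _ _ _)

theorem augMul_zero (a : augIdeal ε) : augMul a 0 = 0 := Subtype.ext (mul_zero _)

theorem zero_augMul (b : A) : augMul (0 : augIdeal ε) b = 0 := Subtype.ext (zero_mul _)

end AugMul

theorem rmul_g (a b : T.bar) (c d : A) :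
    rmul k c d (T.g a b) = T.g (augMul a c) (augMul b d) := (T.g_augMul a b c d).symm

theorem f_augMul (a b : T.bar) : T.f (augMul a (b : A)) =
    lmul (a : A) (T.f b) + rmul k (b : A) 1 (T.f a) + rmul k 1 (b : A) (T.f a) + T.g a b + T.g b a :=
  T.f_mul a b

theorem rmul_f (a b c : T.bar) : rmul k (b : A) (c : A) (T.f a) =
    lmul (a : A) (T.g b c) - T.g (augMul a b) c - T.g b (augMul a c) := T.f_smul a b c

theorem swap_lmul (a : A) (μ : M) : T.swap (lmul a μ) = lmul a (T.swap μ) := T.swap_smul a μ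

theorem swap_rmul (a b : A) (μ : M) : T.swap (rmul k a b μ) = rmul k b a (T.swap μ) :=
  T.swap_op_smul a b μ

/-- The coefficient of `y` at a pair of slots in any order, with `coef j i = swap (coef i j)`. -/
def coef {n : ℕ} (y : T.space n) (i j : Fin n) : M :=
  if h : i < j then y.2.2 ⟨(i, j), h⟩ else if h : j < i then T.swap (y.2.2 ⟨(j, i), h⟩) else 0

theorem coef_of_lt {n : ℕ} (y : T.space n) (i j : Fin n) (h : i < j) :
    T.coef y i j = y.2.2 ⟨(i, j), h⟩ := dif_pos h

theorem swap_coef {n : ℕ} (y : T.space n) (i j : Fin n) :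
    T.swap (T.coef y i j) = T.coef y j i := by
  rcases lt_trichotomy i j with h | rfl | h
  · simp [coef, h, h.not_gt]
  · simp [coef]
  · simp [coef, h, h.not_gt, T.swap_swap]

theorem coef_smul {n : ℕ} (c : k) (y : T.space n) (i j : Fin n) :
    T.coef (c • y) i j = c • T.coef y i j := by
  simp only [coef]; split_ifs <;> simp

theorem coef_add {n : ℕ} (y z : T.space n) (i j : Fin n) :
    T.coef (y + z) i j = T.coef y i j + T.coef z i j := by
  simp only [coef]; split_ifs <;> simp

/-- Pairs i < j would suffice; asking for all i ≠ j lets later arguments sort slots by their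
relation to a block without knowing their order. -/
theorem space_ext {n : ℕ} {y z : T.space n} (h₀ : y.1 = z.1) (h₁ : ∀ i, y.2.1 i = z.2.1 i)
    (h₂ : ∀ i j, i ≠ j → T.coef y i j = T.coef z i j) : y = z := by
  refine Prod.ext h₀ (Prod.ext (funext h₁) (funext fun q => ?_))
  have := h₂ q.1.1 q.1.2 q.2.ne
  rwa [coef_of_lt _ _ _ _ q.2, coef_of_lt _ _ _ _ q.2] at this

end TridentSystem

theorem sum_ite_eq_and {ι N : Type*} [DecidableEq ι] [AddCommMonoid N] (s : Finset ι) (x : ι)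
    (c : ι → Prop) [DecidablePred c] (μ : N) :
    ∑ r ∈ s, (if x = r ∧ c r then μ else 0) = if x ∈ s ∧ c x then μ else 0 := by
  simp [ite_and]

namespace TridentSystem

variable {k : Type u} {A : Type v} {M : Type w} [Field k] [Ring A] [Algebra k A]
  [AddCommGroup M] [Module k M] [Module A M] [IsScalarTower k A M]
  [Module (A ⊗[k] A)ᵐᵒᵖ M] [IsScalarTower k (A ⊗[k] A)ᵐᵒᵖ M]
  [SMulCommClass A (A ⊗[k] A)ᵐᵒᵖ M] (T : TridentSystem k A M)

/-! ### Coordinates of the elementary compositions -/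

section Coordinates

variable {n p : ℕ}

theorem phi_fst (i : ℕ) (a : T.bar) : (T.phi n i a).1 = 0 := rfl

theorem phi_slot (i : ℕ) (a : T.bar) (r : Fin n) :
    (T.phi n i a).2.1 r = if (r : ℕ) = i then a else 0 := rfl

theorem phi_pair (i : ℕ) (a : T.bar) (q : Pairs n) : (T.phi n i a).2.2 q = 0 := rfl

theorem psi_fst (i j : ℕ) (μ : M) : (T.psi n i j μ).1 = 0 := rfl

theorem psi_slot (i j : ℕ) (μ : M) (r : Fin n) : (T.psi n i j μ).2.1 r = 0 := rfl

theorem psi_pair (i j : ℕ) (μ : M) (q : Pairs n) :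
    (T.psi n i j μ).2.2 q = if (q.1.1 : ℕ) = i ∧ (q.1.2 : ℕ) = j then μ else 0 := rfl

theorem sum_psi_left_pair (s : Finset ℕ) (j : ℕ) (μ : M) (q : Pairs n) :
    (∑ r ∈ s, T.psi n r j μ).2.2 q
      = if (q.1.1 : ℕ) ∈ s ∧ (q.1.2 : ℕ) = j then μ else 0 := by
  simp only [Prod.snd_sum, Finset.sum_apply, psi_pair]
  exact sum_ite_eq_and s (q.1.1 : ℕ) (fun _ => (q.1.2 : ℕ) = j) μ

theorem sum_psi_right_pair (s : Finset ℕ) (i : ℕ) (μ : M) (q : Pairs n) :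
    (∑ r ∈ s, T.psi n i r μ).2.2 q
      = if (q.1.1 : ℕ) = i ∧ (q.1.2 : ℕ) ∈ s then μ else 0 := by
  simp only [Prod.snd_sum, Finset.sum_apply, psi_pair, and_comm (a := (q.1.1 : ℕ) = i)]
  exact sum_ite_eq_and s (q.1.2 : ℕ) (fun _ => (q.1.1 : ℕ) = i) μ

theorem sum_psi_psi_pair (i j : ℕ) (μ : M) (q : Pairs n) :
    (∑ r₁ ∈ Finset.Ico i j, ∑ r₂ ∈ Finset.Ico (r₁ + 1) j, T.psi n r₁ r₂ μ).2.2 q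
      = if i ≤ (q.1.1 : ℕ) ∧ (q.1.2 : ℕ) < j then μ else 0 := by
  have hq : (q.1.1 : ℕ) < q.1.2 := q.2
  rw [Prod.snd_sum, Prod.snd_sum, Finset.sum_apply]
  simp only [sum_psi_right_pair]
  rw [sum_ite_eq_and (Finset.Ico i j) (q.1.1 : ℕ) (fun r => (q.1.2 : ℕ) ∈ Finset.Ico (r + 1) j) μ]
  refine if_congr ?_ rfl rfl
  simp only [Finset.mem_Ico]
  omega

theorem sum_phi_pair {ι : Type*} (s : Finset ι) (i : ι → ℕ) (a : ι → T.bar) (q : Pairs n) :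
    (∑ x ∈ s, T.phi n (i x) (a x)).2.2 q = 0 := by
  simp only [Prod.snd_sum, Finset.sum_apply, phi_pair, Finset.sum_const_zero]

theorem sum_psi_slot {ι : Type*} (s : Finset ι) (i j : ι → ℕ) (μ : ι → M) (r : Fin n) :
    (∑ x ∈ s, T.psi n (i x) (j x) (μ x)).2.1 r = 0 := by
  simp only [Prod.snd_sum, Prod.fst_sum, Finset.sum_apply, psi_slot, Finset.sum_const_zero]

theorem phiUnit_fst (s i : ℕ) (a : T.bar) : (T.phiUnit n p s i a).1 = 0 := by
  unfold phiUnit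
  split_ifs <;> simp [Prod.fst_sum, phi_fst, psi_fst]

theorem phiPhi_fst (s i j : ℕ) (a b : T.bar) : (T.phiPhi n p s i j a b).1 = 0 := by
  unfold phiPhi
  split_ifs <;> simp [Prod.fst_sum, phi_fst, psi_fst]

theorem phiPsi_fst (s i j₁ j₂ : ℕ) (a : T.bar) (μ : M) : (T.phiPsi p s i j₁ j₂ a μ).1 = 0 := by
  unfold phiPsi
  split_ifs <;> rfl

theorem psiUnit_fst (s i₁ i₂ : ℕ) (μ : M) : (T.psiUnit n p s i₁ i₂ μ).1 = 0 := by
  unfold psiUnit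
  split_ifs <;> simp [Prod.fst_sum, psi_fst]

theorem psiPhi_fst (s i₁ i₂ j : ℕ) (μ : M) (b : T.bar) :
    (T.psiPhi n p s i₁ i₂ j μ b).1 = 0 := by
  unfold psiPhi
  split_ifs <;> rfl

/-- The condition says that position r of the result descends from slot i: it lies in the block if i
= s, and is the shifted slot i otherwise. -/
theorem phiUnit_slot (s i : ℕ) (a : T.bar) (r : Fin p) : (T.phiUnit n p s i a).2.1 r =
    if i < s ∧ (r : ℕ) = i ∨ i = s ∧ s ≤ r ∧ r < s + n ∨ s < i ∧ (r : ℕ) = i + n - 1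
    then a else 0 := by
  unfold phiUnit
  split_ifs with h₁ h₂ h₃ h₄ h₅ <;>
    simp only [Prod.snd_add, Prod.fst_add, Pi.add_apply, phi_slot,
      Finset.sum_ite_eq, Finset.mem_Ico, Prod.snd_sum, Prod.fst_sum, Finset.sum_apply, psi_slot,
      Finset.sum_const_zero, add_zero] <;> first | rw [if_pos (by omega)] | rw [if_neg (by omega)]

theorem phiUnit_pair (s i : ℕ) (a : T.bar) (q : Pairs p) : (T.phiUnit n p s i a).2.2 q =
    if i = s ∧ s ≤ q.1.1 ∧ q.1.2 < s + n then T.f a else 0 := by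
  unfold phiUnit
  split_ifs with h₁ h₂ h₃ h₄ h₅ <;>
    simp only [Prod.snd_add, Pi.add_apply, sum_phi_pair, phi_pair, sum_psi_psi_pair, zero_add] <;>
    first | omega | rw [if_pos (by omega)] | rw [if_neg (by omega)]

theorem phiPhi_slot (s i j : ℕ) (a b : T.bar) (r : Fin p) : (T.phiPhi n p s i j a b).2.1 r =
    if i = s ∧ (r : ℕ) = i + j then augMul a (b : A) else 0 := by
  unfold phiPhi
  split_ifs with h₁ h₂ h₃ h₄ h₅ <;>
    simp only [Prod.snd_add, Prod.fst_add, Pi.add_apply, phi_slot, psi_slot, sum_psi_slot,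
      zero_add, add_zero] <;>
    first | omega | rw [if_pos (by omega)] | rw [if_neg (by omega)]

/-- The mutually exclusive cases are written as a sum, so that after summation over i and j each
term can be evaluated separately. The ordering of q supplies the omitted bounds. -/
theorem phiPhi_pair (s i j : ℕ) (a b : T.bar) (q : Pairs p) : (T.phiPhi n p s i j a b).2.2 q =
    (if i < s ∧ (q.1.1 : ℕ) = i ∧ (q.1.2 : ℕ) = s + j then T.g a b else 0)
    + (if i = s ∧ s ≤ q.1.1 ∧ (q.1.2 : ℕ) = s + j then T.g a b + rmul k 1 (b : A) (T.f a) else 0)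
    + (if i = s ∧ (q.1.1 : ℕ) = s + j ∧ q.1.2 < s + n then
        T.g b a + rmul k (b : A) 1 (T.f a) else 0)
    + (if s < i ∧ (q.1.1 : ℕ) = s + j ∧ (q.1.2 : ℕ) = i + n - 1 then T.g b a else 0) := by
  have hq : (q.1.1 : ℕ) < q.1.2 := q.2
  unfold phiPhi
  rcases lt_trichotomy i s with h | rfl | h
  · simp only [h, h.ne, h.not_gt, if_true, if_false, psi_pair, true_and, false_and, add_zero]
  · simp only [lt_irrefl, if_true, if_false, true_and, false_and, Prod.snd_add, Pi.add_apply,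
      phi_pair, sum_psi_left_pair, sum_psi_right_pair, add_zero, zero_add, Finset.mem_Ico, rmul]
    congr 1 <;> refine if_congr ?_ rfl rfl <;> omega
  · simp only [h, h.ne', h.not_gt, if_false, psi_pair, true_and, false_and, add_zero, zero_add]

theorem phiPsi_slot (s i j₁ j₂ : ℕ) (a : T.bar) (μ : M) (r : Fin p) :
    (T.phiPsi p s i j₁ j₂ a μ).2.1 r = 0 := by
  unfold phiPsi
  split_ifs <;> rfl

theorem phiPsi_pair (s i j₁ j₂ : ℕ) (a : T.bar) (μ : M) (q : Pairs p) :
    (T.phiPsi p s i j₁ j₂ a μ).2.2 q =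
      if i = s ∧ (q.1.1 : ℕ) = s + j₁ ∧ (q.1.2 : ℕ) = s + j₂ then (a : A) • μ else 0 := by
  unfold phiPsi
  split_ifs with h₁ h₂ h₂ <;> (try simp only [psi_pair]) <;>
    first | (exfalso; omega) | rw [if_pos (by omega)] | rw [if_neg (by omega)] | rfl

theorem psiUnit_slot (s i₁ i₂ : ℕ) (μ : M) (r : Fin p) :
    (T.psiUnit n p s i₁ i₂ μ).2.1 r = 0 := by
  unfold psiUnit
  split_ifs <;> simp only [psi_slot, sum_psi_slot]

/-- The five cases factor: each index of the pair descends independently, by the same relation as in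
`phiUnit_slot`. -/
theorem psiUnit_pair (s i₁ i₂ : ℕ) (hi : i₁ < i₂) (μ : M) (q : Pairs p) :
    (T.psiUnit n p s i₁ i₂ μ).2.2 q =
      if (i₁ < s ∧ (q.1.1 : ℕ) = i₁ ∨ i₁ = s ∧ s ≤ q.1.1 ∧ q.1.1 < s + n ∨
          s < i₁ ∧ (q.1.1 : ℕ) = i₁ + n - 1) ∧
        (i₂ < s ∧ (q.1.2 : ℕ) = i₂ ∨ i₂ = s ∧ s ≤ q.1.2 ∧ q.1.2 < s + n ∨
          s < i₂ ∧ (q.1.2 : ℕ) = i₂ + n - 1) then μ else 0 := by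
  unfold psiUnit
  split_ifs with h₁ <;> simp only [psi_pair, sum_psi_left_pair, sum_psi_right_pair,
      Finset.mem_Ico] <;>
    first | rw [if_pos (by omega)] | rw [if_neg (by omega)]

theorem psiPhi_slot (s i₁ i₂ j : ℕ) (μ : M) (b : T.bar) (r : Fin p) :
    (T.psiPhi n p s i₁ i₂ j μ b).2.1 r = 0 := by
  unfold psiPhi
  split_ifs <;> rfl

theorem psiPhi_pair (s i₁ i₂ j : ℕ) (hi : i₁ < i₂) (μ : M) (b : T.bar) (q : Pairs p) :
    (T.psiPhi n p s i₁ i₂ j μ b).2.2 q =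
      (if s = i₁ ∧ (q.1.1 : ℕ) = i₁ + j ∧ (q.1.2 : ℕ) = i₂ + n - 1 then rmul k (b : A) 1 μ
        else 0)
      + (if s = i₂ ∧ (q.1.1 : ℕ) = i₁ ∧ (q.1.2 : ℕ) = i₂ + j then rmul k 1 (b : A) μ else 0) := by
  unfold psiPhi
  rcases eq_or_ne s i₁ with rfl | h
  · simp only [if_true, true_and, hi.ne, false_and, if_false, add_zero, psi_pair, rmul]
  · rcases eq_or_ne s i₂ with rfl | h'
    · simp only [h, if_true, if_false, true_and, false_and, zero_add, psi_pair, rmul]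
    · simp only [h, h', if_false, false_and, zero_add]
      rfl

end Coordinates

/-! ### The symmetric group action in coordinates -/

section Action

variable {n : ℕ}

theorem psiAct_fst (σ : Equiv.Perm (Fin n)) (i j : Fin n) (μ : M) :
    (T.psiAct σ i j μ).1 = 0 := by
  unfold psiAct
  split_ifs <;> rfl

theorem psiAct_slot (σ : Equiv.Perm (Fin n)) (i j : Fin n) (μ : M) (r : Fin n) :
    (T.psiAct σ i j μ).2.1 r = 0 := by
  unfold psiAct
  split_ifs <;> rfl

theorem act_fst (σ : Equiv.Perm (Fin n)) (y : T.space n) : (T.actFun σ y).1 = y.1 := by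
  simp [actFun, unit, Prod.fst_sum, phi_fst, psiAct_fst]

theorem act_slot (σ : Equiv.Perm (Fin n)) (y : T.space n) (r : Fin n) :
    (T.actFun σ y).2.1 r = y.2.1 (σ r) := by
  simp only [actFun, unit, Prod.snd_add, Prod.fst_add, Prod.smul_snd, Prod.smul_fst,
    Pi.add_apply, smul_zero, Prod.fst_sum, Prod.snd_sum, Finset.sum_apply, psiAct_slot, phi_slot,
    Finset.sum_const_zero, add_zero, zero_add]
  rw [Finset.sum_eq_single (σ r)]
  · simp
  · intro i _ hi
    rw [if_neg]
    intro e
    exact hi (by rw [Fin.ext e]; simp)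
  · simp

/-- Only the pair formed by σ i and σ j contributes to position (i, j). If σ reverses their order,
the `swap` in `psiAct` is exactly the one built into `coef`. -/
theorem act_coef (σ : Equiv.Perm (Fin n)) (y : T.space n) (i j : Fin n) :
    T.coef (T.actFun σ y) i j = T.coef y (σ i) (σ j) := by
  wlog hij : i < j generalizing i j
  · rcases eq_or_ne i j with rfl | hne
    · simp [coef]
    · rw [← swap_coef, this j i (lt_of_le_of_ne (not_lt.1 hij) hne.symm), swap_coef]
  rw [coef_of_lt _ _ _ _ hij]
  simp only [actFun, unit, Prod.snd_add, Prod.smul_snd, Pi.add_apply, smul_zero, Prod.snd_sum,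
    Finset.sum_apply, phi_pair, Finset.sum_const_zero, zero_add]
  rcases lt_trichotomy (σ i) (σ j) with h | h | h
  · rw [coef_of_lt _ _ _ _ h, Finset.sum_eq_single ⟨(σ i, σ j), h⟩]
    · simp [psiAct, hij, psi_pair]
    · rintro ⟨⟨x, y⟩, hxy⟩ _ hne
      simp only [psiAct]
      split_ifs with hs
      · rw [psi_pair, if_neg]
        rintro ⟨e₁, e₂⟩
        refine hne ?_
        simp only [Fin.val_inj] at e₁ e₂
        simp [e₁, e₂]
      · rw [psi_pair, if_neg]
        rintro ⟨e₁, e₂⟩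
        simp only [Fin.val_inj] at e₁ e₂
        subst e₁ e₂
        simp at h
        exact absurd hxy h.not_gt
    · simp
  · exact absurd (σ.injective h) hij.ne
  · rw [← swap_coef, coef_of_lt _ _ _ _ h, Finset.sum_eq_single ⟨(σ j, σ i), h⟩]
    · simp [psiAct, hij.not_gt, psi_pair]
    · rintro ⟨⟨x, y⟩, hxy⟩ _ hne
      simp only [psiAct]
      split_ifs with hs
      · rw [psi_pair, if_neg]
        rintro ⟨e₁, e₂⟩
        simp only [Fin.val_inj] at e₁ e₂
        subst e₁ e₂
        simp at h
        exact absurd hxy h.not_gt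
      · rw [psi_pair, if_neg]
        rintro ⟨e₁, e₂⟩
        refine hne ?_
        simp only [Fin.val_inj] at e₁ e₂
        simp [e₁, e₂]
    · simp

end Action

end TridentSystem

/-! ### Sums with at most one nonzero term -/

section Sums

variable {ι κ N : Type*} [Fintype ι] [Fintype κ] [AddCommMonoid N]

theorem sum_ite_unique (c : ι → Prop) [DecidablePred c] (F : ι → N) (x : ι)
    (hx : ∀ i, c i ↔ i = x) : ∑ i, (if c i then F i else 0) = F x := by
  classical
  simp [hx]

theorem sum_ite_never (c : ι → Prop) [DecidablePred c] (F : ι → N) (h : ∀ i, ¬ c i) :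
    ∑ i, (if c i then F i else 0) = 0 := by
  simp [h]

theorem sum_sum_ite_unique (c : ι → κ → Prop) [∀ i, DecidablePred (c i)] (F : ι → κ → N)
    (x : ι) (y : κ) (hx : ∀ i j, c i j ↔ i = x ∧ j = y) :
    ∑ i, ∑ j, (if c i j then F i j else 0) = F x y := by
  classical
  simp [hx, ite_and]

theorem sum_sum_ite_never (c : ι → κ → Prop) [∀ i, DecidablePred (c i)] (F : ι → κ → N)
    (h : ∀ i j, ¬ c i j) : ∑ i, ∑ j, (if c i j then F i j else 0) = 0 := by
  simp [h]

end Sums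

/-! ### Partial composition in coordinates -/

namespace TridentSystem

variable {k : Type u} {A : Type v} {M : Type w} [Field k] [Ring A] [Algebra k A]
  [AddCommGroup M] [Module k M] [Module A M] [IsScalarTower k A M]
  [Module (A ⊗[k] A)ᵐᵒᵖ M] [IsScalarTower k (A ⊗[k] A)ᵐᵒᵖ M]
  [SMulCommClass A (A ⊗[k] A)ᵐᵒᵖ M] (T : TridentSystem k A M) {m n p : ℕ}

theorem Pairs.eq_iff (q r : Pairs n) :
    q = r ↔ (q.1.1 : ℕ) = r.1.1 ∧ (q.1.2 : ℕ) = r.1.2 := by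
  rw [Subtype.ext_iff, Prod.ext_iff, Fin.ext_iff, Fin.ext_iff]

theorem comp_fst (s : Fin m) (y : T.space m) (z : T.space n) :
    (T.compFun p s y z).1 = y.1 * z.1 := by
  simp [compFun, unit, Prod.fst_sum, phi_fst, psi_fst, phiUnit_fst, phiPhi_fst, phiPsi_fst,
    psiUnit_fst, psiPhi_fst]

theorem comp_slot (s : Fin m) (y : T.space m) (z : T.space n) (r : Fin p) :
    (T.compFun p s y z).2.1 r =
      y.1 • ∑ j : Fin n, (if (r : ℕ) = s + j then z.2.1 j else 0)
      + z.1 • ∑ i : Fin m, (if (i : ℕ) < s ∧ (r : ℕ) = i ∨ (i : ℕ) = s ∧ s ≤ (r : ℕ) ∧ (r : ℕ) < s + n ∨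
          (s : ℕ) < i ∧ (r : ℕ) = i + n - 1 then y.2.1 i else 0)
      + ∑ i : Fin m, ∑ j : Fin n, (if (i : ℕ) = s ∧ (r : ℕ) = i + j then
          augMul (y.2.1 i) (z.2.1 j : A) else 0) := by
  simp only [compFun, unit, Prod.snd_add, Prod.fst_add, Prod.smul_snd, Prod.smul_fst,
    Pi.add_apply, Pi.smul_apply, smul_zero, Prod.fst_sum, Prod.snd_sum,
    Finset.sum_apply, psi_slot, phi_slot, phiUnit_slot, phiPhi_slot, phiPsi_slot, psiUnit_slot,
    psiPhi_slot, Finset.sum_const_zero, add_zero, zero_add]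

theorem comp_slot_out (h : p + 1 = m + n) (s : Fin m) (y : T.space m) (z : T.space n)
    (j : {j // j ≠ s}) :
    (T.compFun p s y z).2.1 (blockOut h s j) = z.1 • y.2.1 j := by
  have hj : (j.1 : ℕ) ≠ s := fun e => j.2 (Fin.ext e)
  rw [comp_slot, blockOut_val, sum_ite_never, sum_ite_unique _ _ j.1, sum_sum_ite_never,
    smul_zero, zero_add, add_zero]
  · intro i j
    split_ifs <;> omega
  · intro i
    rw [Fin.ext_iff]
    split_ifs <;> omega
  · intro i
    split_ifs <;> omega

theorem comp_slot_in (h : p + 1 = m + n) (s : Fin m) (y : T.space m) (z : T.space n)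
    (t : Fin n) :
    (T.compFun p s y z).2.1 (blockIn h s t) =
      z.1 • y.2.1 s + y.1 • z.2.1 t + augMul (y.2.1 s) (z.2.1 t : A) := by
  rw [comp_slot, blockIn_val, sum_ite_unique _ _ t, sum_ite_unique _ _ s,
    sum_sum_ite_unique _ _ s t, add_comm (y.1 • _)]
  · intro i j
    simp only [Fin.ext_iff]
    omega
  · intro i
    rw [Fin.ext_iff]
    omega
  · intro i
    rw [Fin.ext_iff]
    omega

/-- The positions are free numbers r₁, r₂, so that block positions can be substituted and each
condition settled by linear arithmetic. -/
theorem comp_pair (s : Fin m) (y : T.space m) (z : T.space n) (q : Pairs p) (r₁ r₂ : ℕ)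
    (h₁ : (q.1.1 : ℕ) = r₁) (h₂ : (q.1.2 : ℕ) = r₂) :
    (T.compFun p s y z).2.2 q =
      y.1 • ∑ q' : Pairs n, (if r₁ = s + q'.1.1 ∧ r₂ = s + q'.1.2 then
        z.2.2 q' else 0)
      + z.1 • ∑ i : Fin m, (if (i : ℕ) = s ∧ s ≤ r₁ ∧ r₂ < s + n then
          T.f (y.2.1 i) else 0)
      + ((∑ i : Fin m, ∑ j : Fin n,
            if (i : ℕ) < s ∧ r₁ = i ∧ r₂ = s + j then
              T.g (y.2.1 i) (z.2.1 j) else 0)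
        + (∑ i : Fin m, ∑ j : Fin n,
            if (i : ℕ) = s ∧ s ≤ r₁ ∧ r₂ = s + j then
              T.g (y.2.1 i) (z.2.1 j) + rmul k 1 (z.2.1 j : A) (T.f (y.2.1 i)) else 0)
        + (∑ i : Fin m, ∑ j : Fin n,
            if (i : ℕ) = s ∧ r₁ = s + j ∧ r₂ < s + n then
              T.g (z.2.1 j) (y.2.1 i) + rmul k (z.2.1 j : A) 1 (T.f (y.2.1 i)) else 0)
        + (∑ i : Fin m, ∑ j : Fin n,
            if (s : ℕ) < i ∧ r₁ = s + j ∧ r₂ = i + n - 1 then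
              T.g (z.2.1 j) (y.2.1 i) else 0))
      + (∑ i : Fin m, ∑ q' : Pairs n,
          if (i : ℕ) = s ∧ r₁ = s + q'.1.1 ∧ r₂ = s + q'.1.2 then
            (y.2.1 i : A) • z.2.2 q' else 0)
      + z.1 • (∑ q' : Pairs m, if ((q'.1.1 : ℕ) < s ∧ r₁ = q'.1.1 ∨
              (q'.1.1 : ℕ) = s ∧ s ≤ r₁ ∧ r₁ < s + n ∨
              (s : ℕ) < q'.1.1 ∧ r₁ = q'.1.1 + n - 1) ∧
            ((q'.1.2 : ℕ) < s ∧ r₂ = q'.1.2 ∨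
              (q'.1.2 : ℕ) = s ∧ s ≤ r₂ ∧ r₂ < s + n ∨
              (s : ℕ) < q'.1.2 ∧ r₂ = q'.1.2 + n - 1) then y.2.2 q' else 0)
      + ((∑ q' : Pairs m, ∑ j : Fin n, if (s : ℕ) = q'.1.1 ∧ r₁ = q'.1.1 + j ∧
            r₂ = q'.1.2 + n - 1 then rmul k (z.2.1 j : A) 1 (y.2.2 q') else 0)
        + (∑ q' : Pairs m, ∑ j : Fin n, if (s : ℕ) = q'.1.2 ∧ r₁ = q'.1.1 ∧
            r₂ = q'.1.2 + j then rmul k 1 (z.2.1 j : A) (y.2.2 q') else 0)) := by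
  subst h₁ h₂
  have hlt : ∀ q' : Pairs m, (q'.1.1 : ℕ) < q'.1.2 := fun q' => q'.2
  simp only [compFun, unit, Prod.snd_add, Prod.smul_snd, Pi.add_apply, Pi.smul_apply,
    smul_zero, Prod.snd_sum, Finset.sum_apply, psi_pair, phi_pair, phiUnit_pair,
    phiPhi_pair, phiPsi_pair, psiUnit_pair, psiPhi_pair, hlt, Finset.sum_const_zero, zero_add,
    Finset.sum_add_distrib]

theorem comp_coef_out_out (h : p + 1 = m + n) (s : Fin m) (y : T.space m) (z : T.space n)
    (i j : {j // j ≠ s}) :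
    T.coef (T.compFun p s y z) (blockOut h s i) (blockOut h s j) = z.1 • T.coef y i j := by
  wlog hij : blockOut h s i < blockOut h s j generalizing i j
  · rcases eq_or_ne i j with rfl | hne
    · simp [coef]
    · rw [← swap_coef, this j i (lt_of_le_of_ne (not_lt.1 hij)
        fun e => hne (blockOut_injective h s e).symm), map_smul, swap_coef]
  have hi : (i.1 : ℕ) ≠ s := fun e => i.2 (Fin.ext e)
  have hj : (j.1 : ℕ) ≠ s := fun e => j.2 (Fin.ext e)
  have hlt := hij
  obtain ⟨r₁, h₁⟩ : ∃ r₁, (blockOut h s i : ℕ) = r₁ := ⟨_, rfl⟩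
  obtain ⟨r₂, h₂⟩ : ∃ r₂, (blockOut h s j : ℕ) = r₂ := ⟨_, rfl⟩
  rw [Fin.lt_def, h₁, h₂] at hlt
  -- The position formula is restated without truncated subtraction.
  have hr₁ : (i.1 : ℕ) < s ∧ r₁ = i.1 ∨ (s : ℕ) < i.1 ∧ r₁ + 1 = i.1 + n := by
    rw [← h₁, blockOut_val]
    split_ifs <;> omega
  have hr₂ : (j.1 : ℕ) < s ∧ r₂ = j.1 ∨ (s : ℕ) < j.1 ∧ r₂ + 1 = j.1 + n := by
    rw [← h₂, blockOut_val]
    split_ifs <;> omega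
  have hlt' : i.1 < j.1 := by
    rw [Fin.lt_def]
    omega
  have hlt'' : (i.1 : ℕ) < j.1 := hlt'
  rw [coef_of_lt _ _ _ _ hij, coef_of_lt _ _ _ _ hlt', T.comp_pair s y z _ r₁ r₂ h₁ h₂]
  -- Of the ten sums only the one from `psiUnit` survives, with its single term at (i, j).
  rw [sum_ite_never, sum_ite_never, sum_sum_ite_never, sum_sum_ite_never, sum_sum_ite_never,
    sum_sum_ite_never, sum_sum_ite_never, sum_ite_unique _ _ ⟨(i.1, j.1), hlt'⟩,
    sum_sum_ite_never, sum_sum_ite_never]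
  · simp only [smul_zero, add_zero, zero_add]
  all_goals intros
  all_goals try simp only [Pairs.eq_iff]
  all_goals omega

/-- Distinctness matters: on the diagonal `coef` is zero but the terms in f need not be. Exchanging
t and u is compatible with `swap`, since f is invariant, the two actions on f are interchanged, and
so are the two values of g. -/
theorem comp_coef_in_in (h : p + 1 = m + n) (s : Fin m) (y : T.space m) (z : T.space n)
    (t u : Fin n) (htu : t ≠ u) :
    T.coef (T.compFun p s y z) (blockIn h s t) (blockIn h s u) =
      y.1 • T.coef z t u + lmul (y.2.1 s : A) (T.coef z t u) + z.1 • T.f (y.2.1 s)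
        + rmul k (z.2.1 t : A) 1 (T.f (y.2.1 s)) + rmul k 1 (z.2.1 u : A) (T.f (y.2.1 s))
        + T.g (y.2.1 s) (z.2.1 u) + T.g (z.2.1 t) (y.2.1 s) := by
  wlog hlt : t < u generalizing t u
  · rw [← swap_coef, this u t htu.symm (lt_of_le_of_ne (not_lt.1 hlt) htu.symm)]
    simp only [map_add, map_smul, swap_lmul, swap_rmul, swap_f, swap_g, swap_coef]
    abel
  have hlt' : (t : ℕ) < u := hlt
  have hb : blockIn h s t < blockIn h s u := by
    rw [Fin.lt_def, blockIn_val, blockIn_val]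
    omega
  rw [coef_of_lt _ _ _ _ hb, coef_of_lt _ _ _ _ hlt,
    T.comp_pair s y z _ (s + t) (s + u) rfl rfl]
  rw [sum_ite_unique _ _ ⟨(t, u), hlt⟩, sum_ite_unique _ _ s, sum_sum_ite_never,
    sum_sum_ite_unique _ _ s u, sum_sum_ite_unique _ _ s t,
    sum_sum_ite_never, sum_sum_ite_unique _ _ s ⟨(t, u), hlt⟩, sum_ite_never,
    sum_sum_ite_never, sum_sum_ite_never]
  · simp only [smul_zero, add_zero, zero_add, lmul]
    abel
  all_goals intros
  all_goals try simp only [Pairs.eq_iff, Fin.ext_iff]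
  all_goals omega

/-- One formula covers old slots on both sides of the block: for i after s, both sides are images
under `swap` of the formula with the block slot first. -/
theorem comp_coef_out_in (h : p + 1 = m + n) (s : Fin m) (y : T.space m) (z : T.space n)
    (i : {j // j ≠ s}) (t : Fin n) :
    T.coef (T.compFun p s y z) (blockOut h s i) (blockIn h s t) =
      z.1 • T.coef y i s + rmul k 1 (z.2.1 t : A) (T.coef y i s) + T.g (y.2.1 i) (z.2.1 t) := by
  have hi : (i.1 : ℕ) ≠ s := fun e => i.2 (Fin.ext e)
  rcases lt_or_gt_of_ne hi with hlt | hlt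
  · have hb : blockOut h s i < blockIn h s t := by
      rw [Fin.lt_def, blockOut_val, blockIn_val, if_pos hlt]
      omega
    have hlt' : i.1 < s := hlt
    rw [coef_of_lt _ _ _ _ hb, coef_of_lt _ _ _ _ hlt',
      T.comp_pair s y z _ i.1 (s + t) (by simp only [blockOut_val, if_pos hlt]) rfl]
    rw [sum_ite_never, sum_ite_never, sum_sum_ite_unique _ _ i.1 t, sum_sum_ite_never,
      sum_sum_ite_never, sum_sum_ite_never, sum_sum_ite_never,
      sum_ite_unique _ _ ⟨(i.1, s), hlt'⟩, sum_sum_ite_never,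
      sum_sum_ite_unique _ _ ⟨(i.1, s), hlt'⟩ t]
    · simp only [smul_zero, add_zero, zero_add]
      abel
    all_goals intros
    all_goals try simp only [Pairs.eq_iff, Fin.ext_iff]
    all_goals omega
  · have hb : blockIn h s t < blockOut h s i := by
      rw [Fin.lt_def, blockOut_val, blockIn_val, if_neg hlt.not_gt]
      omega
    have hlt' : s < i.1 := hlt
    rw [← swap_coef, ← T.swap_coef y s, coef_of_lt _ _ _ _ hb, coef_of_lt _ _ _ _ hlt',
      T.comp_pair s y z _ (s + t) (i.1 + n - 1) rfl
        (by simp only [blockOut_val, if_neg hlt.not_gt])]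
    rw [sum_ite_never, sum_ite_never, sum_sum_ite_never, sum_sum_ite_never,
      sum_sum_ite_never, sum_sum_ite_unique _ _ i.1 t, sum_sum_ite_never,
      sum_ite_unique _ _ ⟨(s, i.1), hlt'⟩, sum_sum_ite_unique _ _ ⟨(s, i.1), hlt'⟩ t,
      sum_sum_ite_never]
    · simp only [smul_zero, add_zero, zero_add, map_add, map_smul, swap_rmul, swap_g]
      abel
    all_goals intros
    all_goals try simp only [Pairs.eq_iff, Fin.ext_iff]
    all_goals omega

theorem comp_coef_in_out (h : p + 1 = m + n) (s : Fin m) (y : T.space m) (z : T.space n)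
    (i : {j // j ≠ s}) (t : Fin n) :
    T.coef (T.compFun p s y z) (blockIn h s t) (blockOut h s i) =
      z.1 • T.coef y s i + rmul k (z.2.1 t : A) 1 (T.coef y s i) + T.g (z.2.1 t) (y.2.1 i) := by
  rw [← swap_coef, comp_coef_out_in]
  simp only [map_add, map_smul, swap_rmul, swap_g, swap_coef]

end TridentSystem

/-! ### The operad axioms -/

namespace TridentSystem

variable {k : Type u} {A : Type v} {M : Type w} [Field k] [Ring A] [Algebra k A]
  [AddCommGroup M] [Module k M] [Module A M] [IsScalarTower k A M]
  [Module (A ⊗[k] A)ᵐᵒᵖ M] [IsScalarTower k (A ⊗[k] A)ᵐᵒᵖ M]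
  [SMulCommClass A (A ⊗[k] A)ᵐᵒᵖ M] (T : TridentSystem k A M) {l m n a b p : ℕ}

theorem unit_fst (n : ℕ) : (T.unit n).1 = 1 := rfl

theorem unit_slot (n : ℕ) (r : Fin n) : (T.unit n).2.1 r = 0 := rfl

theorem unit_coef (n : ℕ) (i j : Fin n) : T.coef (T.unit n) i j = 0 := by
  simp [coef, unit]

theorem slot_add (y z : T.space n) (r : Fin n) : (y + z).2.1 r = y.2.1 r + z.2.1 r := rfl

theorem slot_smul (c : k) (y : T.space n) (r : Fin n) : (c • y).2.1 r = c • y.2.1 r := rfl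

theorem fst_add (y z : T.space n) : (y + z).1 = y.1 + z.1 := rfl

theorem fst_smul (c : k) (y : T.space n) : (c • y).1 = c * y.1 := rfl

/-- Elements of `P(p)` agree if their coordinates agree, the slots being sorted by their
relation to an inserted block. -/
theorem space_ext_block (h : p + 1 = m + n) (s : Fin m) {y z : T.space p} (h₀ : y.1 = z.1)
    (out : ∀ i, y.2.1 (blockOut h s i) = z.2.1 (blockOut h s i))
    (ins : ∀ t, y.2.1 (blockIn h s t) = z.2.1 (blockIn h s t))
    (out_out : ∀ i j, i ≠ j → T.coef y (blockOut h s i) (blockOut h s j) =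
      T.coef z (blockOut h s i) (blockOut h s j))
    (out_in : ∀ i t, T.coef y (blockOut h s i) (blockIn h s t) =
      T.coef z (blockOut h s i) (blockIn h s t))
    (in_in : ∀ t u, t ≠ u → T.coef y (blockIn h s t) (blockIn h s u) =
      T.coef z (blockIn h s t) (blockIn h s u)) : y = z := by
  refine T.space_ext h₀ (fun r => ?_) (fun r₁ r₂ hr => ?_)
  · rcases block_cases h s r with ⟨i, rfl⟩ | ⟨t, rfl⟩
    exacts [out i, ins t]
  · rcases block_cases h s r₁ with ⟨i, rfl⟩ | ⟨t, rfl⟩ <;>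
      rcases block_cases h s r₂ with ⟨j, rfl⟩ | ⟨u, rfl⟩
    · exact out_out i j (ne_of_apply_ne _ hr)
    · exact out_in i u
    · rw [← T.swap_coef y, ← T.swap_coef z, out_in]
    · exact in_in t u (ne_of_apply_ne _ hr)

theorem act_add (σ : Equiv.Perm (Fin n)) (y z : T.space n) :
    T.actFun σ (y + z) = T.actFun σ y + T.actFun σ z :=
  T.space_ext (by simp only [act_fst, fst_add]) (fun _ => by simp only [act_slot, slot_add])
    fun _ _ _ => by simp only [act_coef, coef_add]

theorem act_smul (σ : Equiv.Perm (Fin n)) (c : k) (y : T.space n) :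
    T.actFun σ (c • y) = c • T.actFun σ y :=
  T.space_ext (by simp only [act_fst, fst_smul]) (fun _ => by simp only [act_slot, slot_smul])
    fun _ _ _ => by simp only [act_coef, coef_smul]

theorem act_one (y : T.space n) : T.actFun 1 y = y :=
  T.space_ext (T.act_fst _ _) (fun _ => T.act_slot _ _ _) fun _ _ _ => T.act_coef _ _ _ _

theorem act_mul (σ τ : Equiv.Perm (Fin n)) (y : T.space n) :
    T.actFun (σ * τ) y = T.actFun τ (T.actFun σ y) :=
  T.space_ext (by simp only [act_fst])
    (fun _ => by simp only [act_slot, Equiv.Perm.mul_apply])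
    fun _ _ _ => by simp only [act_coef, Equiv.Perm.mul_apply]

theorem add_comp (h : p + 1 = m + n) (s : Fin m) (y y' : T.space m) (z : T.space n) :
    T.compFun p s (y + y') z = T.compFun p s y z + T.compFun p s y' z := by
  refine T.space_ext_block h s ?_ (fun i => ?_) (fun t => ?_) (fun i j _ => ?_)
    (fun i t => ?_) (fun t u htu => ?_)
  · simp only [comp_fst, fst_add, add_mul]
  · simp only [comp_slot_out, slot_add, smul_add]
  · simp only [comp_slot_in, slot_add, fst_add, add_augMul]
    module
  · simp only [comp_coef_out_out, coef_add, smul_add]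
  · simp only [comp_coef_out_in, coef_add, slot_add, rmul_add, map_add, LinearMap.add_apply]
    module
  · simp only [comp_coef_in_in _ _ _ _ _ _ _ htu, coef_add, slot_add, fst_add, rmul_add, map_add,
      LinearMap.add_apply, Submodule.coe_add, add_lmul]
    module

theorem smul_comp (h : p + 1 = m + n) (s : Fin m) (c : k) (y : T.space m) (z : T.space n) :
    T.compFun p s (c • y) z = c • T.compFun p s y z := by
  refine T.space_ext_block h s ?_ (fun i => ?_) (fun t => ?_) (fun i j _ => ?_)
    (fun i t => ?_) (fun t u htu => ?_)
  · simp only [comp_fst, fst_smul, mul_assoc]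
  · simp only [comp_slot_out, slot_smul]
    module
  · simp only [comp_slot_in, slot_smul, fst_smul, smul_augMul]
    module
  · simp only [comp_coef_out_out, coef_smul]
    module
  · simp only [comp_coef_out_in, coef_smul, slot_smul, rmul_smul, map_smul, LinearMap.smul_apply]
    module
  · simp only [comp_coef_in_in _ _ _ _ _ _ _ htu, coef_smul, slot_smul, fst_smul, rmul_smul,
      map_smul, LinearMap.smul_apply, Submodule.coe_smul, smul_lmul]
    module

theorem comp_add (h : p + 1 = m + n) (s : Fin m) (y : T.space m) (z z' : T.space n) :
    T.compFun p s y (z + z') = T.compFun p s y z + T.compFun p s y z' := by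
  refine T.space_ext_block h s ?_ (fun i => ?_) (fun t => ?_) (fun i j _ => ?_)
    (fun i t => ?_) (fun t u htu => ?_)
  · simp only [comp_fst, fst_add, mul_add]
  · simp only [comp_slot_out, slot_add, fst_add, add_smul]
  · simp only [comp_slot_in, slot_add, fst_add, augMul_add, Submodule.coe_add]
    module
  · simp only [comp_coef_out_out, coef_add, fst_add, add_smul]
  · simp only [comp_coef_out_in, coef_add, slot_add, fst_add, rmul_add_right, map_add,
      Submodule.coe_add]
    module
  · simp only [comp_coef_in_in _ _ _ _ _ _ _ htu, coef_add, slot_add, fst_add, rmul_add_right,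
      add_rmul, map_add, LinearMap.add_apply, Submodule.coe_add, lmul_add]
    module

theorem comp_smul (h : p + 1 = m + n) (s : Fin m) (c : k) (y : T.space m) (z : T.space n) :
    T.compFun p s y (c • z) = c • T.compFun p s y z := by
  refine T.space_ext_block h s ?_ (fun i => ?_) (fun t => ?_) (fun i j _ => ?_)
    (fun i t => ?_) (fun t u htu => ?_)
  · simp only [comp_fst, fst_smul, mul_left_comm]
  · simp only [comp_slot_out, slot_smul, fst_smul, mul_smul]
  · simp only [comp_slot_in, slot_smul, fst_smul, augMul_smul, Submodule.coe_smul]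
    module
  · simp only [comp_coef_out_out, coef_smul, fst_smul, mul_smul]
  · simp only [comp_coef_out_in, coef_smul, slot_smul, fst_smul, smul_rmul_right, map_smul,
      Submodule.coe_smul]
    module
  · simp only [comp_coef_in_in _ _ _ _ _ _ _ htu, coef_smul, slot_smul, fst_smul,
      smul_rmul_right, smul_rmul, map_smul, LinearMap.smul_apply, Submodule.coe_smul,
      lmul_smul]
    module

theorem blockOut_one (i : Fin m) (j : {j // j ≠ i}) :
    blockOut (n := 1) (p := m) rfl i j = j := by
  rw [Fin.ext_iff, blockOut_val]
  split_ifs <;> omega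

theorem blockIn_one (i : Fin m) (t : Fin 1) : blockIn (p := m) rfl i t = i := by
  rw [Fin.ext_iff, blockIn_val]
  omega

theorem blockIn_zero (h : m + 1 = 1 + m) (t : Fin m) : blockIn h 0 t = t := by
  rw [Fin.ext_iff, blockIn_val]
  simp

theorem comp_id (i : Fin m) (y : T.space m) : T.compFun m i y (T.unit 1) = y := by
  refine T.space_ext_block (n := 1) rfl i ?_ (fun i => ?_) (fun t => ?_) (fun i j _ => ?_)
    (fun i t => ?_) (fun t u htu => ?_)
  · simp only [comp_fst, unit_fst, mul_one]
  · rw [comp_slot_out, blockOut_one, unit_fst, one_smul]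
  · rw [comp_slot_in, blockIn_one]
    simp only [unit_fst, unit_slot, one_smul, smul_zero, ZeroMemClass.coe_zero, augMul_zero,
      add_zero]
  · rw [comp_coef_out_out, blockOut_one, blockOut_one, unit_fst, one_smul]
  · rw [comp_coef_out_in, blockOut_one, blockIn_one]
    simp only [unit_fst, unit_slot, one_smul, ZeroMemClass.coe_zero, rmul_zero_right, map_zero,
      add_zero]
  · exact absurd (Subsingleton.elim t u) htu

theorem id_comp (h : m + 1 = 1 + m) (y : T.space m) : T.compFun m 0 (T.unit 1) y = y := by
  refine T.space_ext_block h 0 ?_ (fun i => ?_) (fun t => ?_) (fun i j _ => ?_)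
    (fun i t => ?_) (fun t u htu => ?_)
  · simp only [comp_fst, unit_fst, one_mul]
  · exact absurd (Subsingleton.elim i.1 0) i.2
  · rw [comp_slot_in, blockIn_zero]
    simp only [unit_fst, unit_slot, one_smul, smul_zero, zero_augMul, add_zero, zero_add]
  · exact absurd (Subsingleton.elim i.1 0) i.2
  · exact absurd (Subsingleton.elim i.1 0) i.2
  · rw [T.comp_coef_in_in _ _ _ _ _ _ htu, blockIn_zero, blockIn_zero]
    simp only [unit_fst, unit_slot, one_smul, smul_zero, ZeroMemClass.coe_zero, zero_lmul,
      map_zero, LinearMap.zero_apply, rmul_zero, add_zero]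

theorem comp_act (h : p + 1 = m + n) (s : Fin m) (σ : Equiv.Perm (Fin n)) (y : T.space m)
    (z : T.space n) :
    T.compFun p s y (T.actFun σ z) = T.actFun (permComp h s 1 σ) (T.compFun p s y z) := by
  refine T.space_ext_block h s ?_ (fun i => ?_) (fun t => ?_) (fun i j _ => ?_)
    (fun i t => ?_) (fun t u htu => ?_)
  · simp only [comp_fst, act_fst]
  · simp only [comp_slot_out, act_slot, act_fst, permComp_blockOut, Equiv.Perm.one_apply]
  · simp only [comp_slot_in, act_slot, act_fst, permComp_blockIn, Equiv.Perm.one_apply]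
  · simp only [comp_coef_out_out, act_coef, act_fst, permComp_blockOut, Equiv.Perm.one_apply]
  · simp only [comp_coef_out_in, act_coef, act_slot, act_fst, permComp_blockOut,
      permComp_blockIn, Equiv.Perm.one_apply]
  · have hσ : σ t ≠ σ u := σ.injective.ne htu
    simp only [comp_coef_in_in _ _ _ _ _ _ _ htu, comp_coef_in_in _ _ _ _ _ _ _ hσ, act_coef,
      act_slot, act_fst, permComp_blockIn, Equiv.Perm.one_apply]

theorem act_comp (h : p + 1 = m + n) (s : Fin m) (ρ : Equiv.Perm (Fin m)) (y : T.space m)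
    (z : T.space n) :
    T.compFun p s (T.actFun ρ y) z = T.actFun (permComp h s ρ 1) (T.compFun p (ρ s) y z) := by
  refine T.space_ext_block h s ?_ (fun i => ?_) (fun t => ?_) (fun i j _ => ?_)
    (fun i t => ?_) (fun t u htu => ?_)
  · simp only [comp_fst, act_fst]
  · simp only [comp_slot_out, act_slot, permComp_blockOut]
  · simp only [comp_slot_in, act_slot, act_fst, permComp_blockIn, Equiv.Perm.one_apply]
  · simp only [comp_coef_out_out, act_coef, permComp_blockOut]
  · simp only [comp_coef_out_in, act_coef, act_slot, permComp_blockOut,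
      permComp_blockIn, Equiv.Perm.one_apply]
  · simp only [comp_coef_in_in _ _ _ _ _ _ _ htu, act_coef, act_slot, act_fst, permComp_blockIn,
      Equiv.Perm.one_apply]

/-- Each slot of the result comes from x, y or z, which gives nine kinds of pairs. With one slot
from y and one from z, the left side contains f(xᵢ)·(yₜ ⊗ zᵤ), which `rmul_f` matches with xᵢ g(yₜ,
zᵤ) on the right. With both from z, f(xᵢyⱼ) is expanded by `f_augMul`, and its mixed terms again by
`rmul_f`. -/
theorem comp_comp_seq (h₁ : a + 1 = l + m) (h₂ : p + 1 = a + n)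
    (h₃ : b + 1 = m + n) (h₄ : p + 1 = l + b) (i : Fin l) (j : Fin m)
    (x : T.space l) (y : T.space m) (z : T.space n) :
    T.compFun p (blockIn h₁ i j) (T.compFun a i x y) z =
      T.compFun p i x (T.compFun b j y z) := by
  refine T.space_ext ?_ (fun r => ?_) (fun r₁ r₂ hr => ?_)
  · simp only [comp_fst, mul_assoc]
  · rcases block_cases_seq h₁ h₂ h₃ h₄ i j r with ⟨t, e₁, e₂⟩ | ⟨t, e₁, e₂⟩ | ⟨t, e₁, e₂⟩
    all_goals
      conv_lhs => rw [e₂]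
      conv_rhs => rw [e₁]
      simp only [comp_slot_out, comp_slot_in, comp_fst, Submodule.coe_smul, Submodule.coe_add,
        coe_augMul, augMul_smul, augMul_add, add_augMul, smul_augMul, augMul_mul]
      module
  · rcases block_cases_seq h₁ h₂ h₃ h₄ i j r₁ with ⟨t, e₁, e₂⟩ | ⟨t, e₁, e₂⟩ | ⟨t, e₁, e₂⟩ <;>
    rcases block_cases_seq h₁ h₂ h₃ h₄ i j r₂ with ⟨u, f₁, f₂⟩ | ⟨u, f₁, f₂⟩ | ⟨u, f₁, f₂⟩
    all_goals
      conv_lhs => rw [e₂, f₂]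
      conv_rhs => rw [e₁, f₁]
      rw [e₁, f₁] at hr
    -- When both slots lie in the block replacing i, `comp_coef_in_in` needs distinct slots at each
    -- level where it is used; the inequalities are prepared for `simp`.
    case' inr.inl.inr.inl =>
      have hr₁ := ne_of_apply_ne _ hr
      have hr₂ : t.1 ≠ u.1 := fun e => hr₁ (by rw [Subtype.ext e])
    case' inr.inl.inr.inr =>
      have ht := t.2
    case' inr.inr.inr.inl =>
      have hu := u.2.symm
    case' inr.inr.inr.inr =>
      have hr₁ := ne_of_apply_ne _ hr
      have hr₂ := ne_of_apply_ne _ hr₁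
    all_goals
      simp only [comp_coef_out_out, comp_coef_out_in, comp_coef_in_out, comp_coef_in_in,
        comp_slot_out, comp_slot_in, comp_fst, ne_eq, blockOut_ne_blockIn, not_false_eq_true,
        (blockOut_ne_blockIn _ _ _ _).symm, *]
      try simp only [Submodule.coe_smul, Submodule.coe_add, coe_augMul, map_add, map_smul,
        LinearMap.add_apply, LinearMap.smul_apply, rmul_add, rmul_smul, rmul_add_right, add_rmul,
        smul_rmul, smul_rmul_right, lmul_add, lmul_smul, add_lmul, smul_lmul, mul_lmul, rmul_lmul,
        rmul_rmul, mul_one, one_mul, rmul_f, f_augMul, rmul_g, augMul_one]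
      module

/-- The blocks act on different tensor factors: between them the pair component is xᵢⱼ·(yₜ ⊗ zᵤ) in
either order, and `rmul_g` handles the terms in g. Within one block, inserting the other only
multiplies by its constant. -/
theorem comp_comp_par (h₁ : a + 1 = l + m) (h₂ : p + 1 = a + n)
    (h₃ : b + 1 = l + n) (h₄ : p + 1 = b + m) (i j : Fin l) (hij : i < j)
    (x : T.space l) (y : T.space m) (z : T.space n) :
    T.compFun p (blockOut h₁ i ⟨j, hij.ne'⟩) (T.compFun a i x y) z =
      T.compFun p (blockOut h₃ j ⟨i, hij.ne⟩) (T.compFun b j x z) y := by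
  refine T.space_ext ?_ (fun r => ?_) (fun r₁ r₂ hr => ?_)
  · simp only [comp_fst]
    ring
  · rcases block_cases_par h₁ h₂ h₃ h₄ i j hij r with
      ⟨t, hi, hj, e₁, e₂⟩ | ⟨t, e₁, e₂⟩ | ⟨t, e₁, e₂⟩
    all_goals
      conv_lhs => rw [e₁]
      conv_rhs => rw [e₂]
      simp only [comp_slot_out, comp_slot_in, comp_fst, smul_augMul]
      module
  · rcases block_cases_par h₁ h₂ h₃ h₄ i j hij r₁ with
      ⟨t, hi, hj, e₁, e₂⟩ | ⟨t, e₁, e₂⟩ | ⟨t, e₁, e₂⟩ <;>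
    rcases block_cases_par h₁ h₂ h₃ h₄ i j hij r₂ with
      ⟨u, hi', hj', f₁, f₂⟩ | ⟨u, f₁, f₂⟩ | ⟨u, f₁, f₂⟩
    case' inr.inl.inr.inl =>
      have htu : t ≠ u := by
        rintro rfl
        exact hr (e₁.trans f₁.symm)
    case' inr.inr.inr.inr =>
      have htu : t ≠ u := by
        rintro rfl
        exact hr (e₁.trans f₁.symm)
    all_goals
      conv_lhs => rw [e₁, f₁]
      conv_rhs => rw [e₂, f₂]
      clear e₁ e₂ f₁ f₂
      simp only [comp_coef_out_out, comp_coef_out_in, comp_coef_in_out, comp_coef_in_in,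
        comp_slot_out, comp_slot_in, comp_fst, ne_eq, not_false_eq_true, *]
      try simp only [Submodule.coe_smul, map_add, map_smul, LinearMap.add_apply,
        LinearMap.smul_apply, rmul_add, rmul_smul, smul_lmul, rmul_rmul, mul_one, one_mul, rmul_g,
        augMul_one]
      module

theorem operad_isOperad : T.operad.IsOperad where
  act_add := T.act_add
  act_smul := T.act_smul
  add_comp := T.add_comp
  smul_comp := T.smul_comp
  comp_add := T.comp_add
  comp_smul h i c y z := T.comp_smul h i c y z
  act_one := T.act_one
  act_mul := T.act_mul
  comp_id := T.comp_id
  id_comp := T.id_comp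
  assoc_seq h₁ h₂ h₃ h₄ i j s hs x y z := by
    obtain rfl : s = blockIn h₁ i j := Fin.ext hs
    exact T.comp_comp_seq h₁ h₂ h₃ h₄ i j x y z
  assoc_par h₁ h₂ h₃ h₄ i j s r hij hs hr x y z := by
    have hij' : (i : ℕ) < j := hij
    obtain rfl : s = blockOut h₁ i ⟨j, hij.ne'⟩ := by
      rw [Fin.ext_iff, blockOut_val]
      dsimp only
      split_ifs <;> omega
    obtain rfl : r = blockOut h₃ j ⟨i, hij.ne⟩ := by
      rw [Fin.ext_iff, blockOut_val]
      dsimp only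
      split_ifs <;> omega
    exact T.comp_comp_par h₁ h₂ h₃ h₄ i j hij x y z
  comp_act := T.comp_act
  act_comp := T.act_comp

end TridentSystem

/-! ### Growth and binomial series -/

open Filter Topology in
/-- A sequence asymptotic to a positive multiple of `n ^ 3` grows with exponent three. -/
theorem tendsto_logb_of_tendsto_div_pow {S : ℕ → ℝ} {c : ℝ} (hc : 0 < c)
    (hS : Tendsto (fun n : ℕ => S n / (n : ℝ) ^ 3) atTop (𝓝 c)) :
    Tendsto (fun n : ℕ => Real.logb n (S n)) atTop (𝓝 3) := by
  have hlog : Tendsto (fun n : ℕ => Real.log n) atTop atTop :=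
    Real.tendsto_log_atTop.comp tendsto_natCast_atTop_atTop
  -- For large n this expression is log_n S(n). The numerator converges to log c while log n
  -- diverges, so the quotient vanishes in the limit.
  have h₁ : Tendsto (fun n : ℕ => 3 + Real.log (S n / (n : ℝ) ^ 3) / Real.log n) atTop
      (𝓝 (3 + 0)) :=
    tendsto_const_nhds.add ((hS.log hc.ne').div_atTop hlog)
  rw [add_zero] at h₁
  refine h₁.congr' ?_
  filter_upwards [hS.eventually (lt_mem_nhds hc), eventually_gt_atTop 1] with n hn hn1
  have hn0 : (0 : ℝ) < n := by positivity
  have hl : 0 < Real.log n := Real.log_pos (by exact_mod_cast hn1)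
  have hSn : S n ≠ 0 := by
    rintro h
    simp [h] at hn
  rw [Real.logb, Real.log_div hSn (by positivity), Real.log_pow]
  field_simp
  push_cast
  ring

-- The partial sums are a cubic polynomial in n; only C(n+1, 3)m contributes to the cubic term, with
-- coefficient m/6.
open Filter Topology in
theorem tendsto_sum_div_pow (d m : ℕ) :
    Tendsto (fun n : ℕ => (∑ i ∈ Finset.range (n + 1), ((1 + i * d + i.choose 2 * m : ℕ) : ℝ))
      / (n : ℝ) ^ 3) atTop (𝓝 (m / 6)) := by
  have hsum : ∀ n : ℕ, (∑ i ∈ Finset.range (n + 1), ((1 + i * d + i.choose 2 * m : ℕ) : ℝ))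
      = (n + 1) + d * (n * (n + 1) / 2) + m * ((n + 1) * n * (n - 1) / 6) := by
    intro n
    induction n with
    | zero => simp
    | succ n ih =>
      rw [Finset.sum_range_succ, ih]
      push_cast [Nat.cast_choose_two]
      ring
  have hinv : Tendsto (fun n : ℕ => (n : ℝ)⁻¹) atTop (𝓝 0) := tendsto_inv_atTop_nhds_zero_nat
  -- The quotient by n³, rewritten as a polynomial in 1/n.
  have hlim : Tendsto (fun n : ℕ => ((n : ℝ)⁻¹ ^ 2 * (1 + (n : ℝ)⁻¹)
      + d * ((n : ℝ)⁻¹ * (1 + (n : ℝ)⁻¹) / 2)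
      + m * ((1 + (n : ℝ)⁻¹) * (1 - (n : ℝ)⁻¹) / 6))) atTop
      (𝓝 ((0 : ℝ) ^ 2 * (1 + 0) + d * (0 * (1 + 0) / 2) + m * ((1 + 0) * (1 - 0) / 6))) :=
    ((((hinv.pow 2).mul (hinv.const_add 1)).add
      (((hinv.mul (hinv.const_add 1)).div_const 2).const_mul _)).add
      ((((hinv.const_add 1).mul (hinv.const_sub 1)).div_const 6).const_mul _))
  have e : ((0 : ℝ) ^ 2 * (1 + 0) + d * (0 * (1 + 0) / 2) + m * ((1 + 0) * (1 - 0) / 6))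
      = m / 6 := by ring
  rw [e] at hlim
  refine hlim.congr' ?_
  filter_upwards [eventually_gt_atTop 0] with n hn
  have hn0 : (n : ℝ) ≠ 0 := by positivity
  rw [hsum]
  field_simp

theorem inverse_one_sub_pow (d : ℕ) :
    Ring.inverse ((1 - PowerSeries.X : PowerSeries ℤ) ^ (d + 1)) =
      PowerSeries.mk fun n => ((d + n).choose d : ℤ) := by
  rw [← PowerSeries.invOneSubPow_inv_eq_one_sub_pow, Units.inv_eq_val_inv, Ring.inverse_unit, inv_inv,
    PowerSeries.invOneSubPow_val_eq_mk_sub_one_add_choose_of_pos ℤ (d + 1) d.succ_pos]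
  rfl

/-! ### Units, the augmentation, dimensions -/

namespace TridentSystem

theorem card_pairs (n : ℕ) : Fintype.card (Pairs n) = n.choose 2 := by
  -- Grouping pairs by their larger element j leaves j choices for the smaller.
  have e : Pairs n ≃ Σ j : Fin n, Fin j :=
    { toFun := fun q => ⟨q.1.2, ⟨q.1.1, q.2⟩⟩
      invFun := fun q => ⟨(⟨q.2, q.2.2.trans q.1.2⟩, q.1), q.2.2⟩
      left_inv := fun _ => rfl
      right_inv := fun _ => rfl }
  rw [Fintype.card_congr e, Fintype.card_sigma]
  simp only [Fintype.card_fin]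
  rw [Fin.sum_univ_eq_sum_range (fun i => i), Finset.sum_range_id, Nat.choose_two_right]

variable {k : Type u} {A : Type v} {M : Type w} [Field k] [Ring A] [Algebra k A]
  [AddCommGroup M] [Module k M] [Module A M] [IsScalarTower k A M]
  [Module (A ⊗[k] A)ᵐᵒᵖ M] [IsScalarTower k (A ⊗[k] A)ᵐᵒᵖ M]
  [SMulCommClass A (A ⊗[k] A)ᵐᵒᵖ M] (T : TridentSystem k A M) {m n p : ℕ}

theorem act_unit (σ : Equiv.Perm (Fin n)) : T.actFun σ (T.unit n) = T.unit n :=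
  T.space_ext (by rw [act_fst]) (fun _ => by rw [act_slot, unit_slot, unit_slot])
    fun _ _ _ => by rw [act_coef, unit_coef, unit_coef]

theorem comp_unit_unit (h : p + 1 = m + n) (s : Fin m) :
    T.compFun p s (T.unit m) (T.unit n) = T.unit p := by
  refine T.space_ext_block h s ?_ (fun i => ?_) (fun t => ?_) (fun i j _ => ?_)
    (fun i t => ?_) (fun t u htu => ?_)
  · simp only [comp_fst, unit_fst, mul_one]
  · simp only [comp_slot_out, unit_slot, smul_zero]
  · simp only [comp_slot_in, unit_slot, smul_zero, zero_augMul, add_zero]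
  · simp only [comp_coef_out_out, unit_coef, smul_zero]
  · simp only [comp_coef_out_in, unit_coef, unit_slot, smul_zero, rmul_zero, map_zero, add_zero]
  · simp only [comp_coef_in_in _ _ _ _ _ _ _ htu, unit_coef, unit_slot, smul_zero, rmul_zero,
      map_zero, add_zero, ZeroMemClass.coe_zero, zero_lmul]

theorem operad_isTwoUnitary : T.operad.IsTwoUnitary (T.unit 0) (T.unit 2) := by
  refine ⟨⟨fun e => one_ne_zero (congrArg Prod.fst e : (1 : k) = 0), fun y => ?_⟩,
    T.comp_unit_unit (m := 2) (n := 0) (p := 1) rfl 0,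
    T.comp_unit_unit (m := 2) (n := 0) (p := 1) rfl 1⟩
  refine ⟨(show T.space 0 from y).1, ?_⟩
  -- P(0) has no slots, so the constant determines the element.
  refine T.space_ext ?_ (fun i => i.elim0) (fun i => i.elim0)
  exact (mul_one _).symm

/-- The augmentation of the operad of a trident system by `Com`. -/
def comHom : OperadData.Hom (OperadData.com k) T.operad where
  app n := LinearMap.toSpanSingleton k (T.space n) (T.unit n)
  map_act {n} σ μ := by
    change (show k from μ) • T.unit n = T.actFun σ ((show k from μ) • T.unit n)
    rw [act_smul, act_unit]
  map_id := one_smul k (T.unit 1)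
  map_comp {m n p} h i μ ν := by
    change ((show k from μ) * (show k from ν)) • T.unit p =
      T.compFun p i ((show k from μ) • T.unit m) ((show k from ν) • T.unit n)
    rw [T.smul_comp h, T.comp_smul h, T.comp_unit_unit h, mul_smul]

theorem comHom_one (n : ℕ) : T.comHom.app n (1 : k) = T.unit n := one_smul k (T.unit n)

section Finite

variable [Module.Finite k A] [Module.Finite k M]

instance : Module.Finite k T.bar :=
  Module.Finite.of_injective (augIdeal T.ε).subtype Subtype.val_injective

theorem operad_isLocallyFinite : T.operad.IsLocallyFinite := fun n =>
  inferInstanceAs (Module.Finite k (T.space n))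

theorem finrank_operad (n : ℕ) : Module.finrank k (T.operad.obj n) =
    1 + n * Module.finrank k T.bar + n.choose 2 * Module.finrank k M := by
  change Module.finrank k (T.space n) = _
  rw [Module.finrank_prod, Module.finrank_prod, Module.finrank_pi_fintype,
    Module.finrank_pi_fintype, Module.finrank_self]
  simp [card_pairs, add_assoc]

/-- Since M is nonzero, the limit m₀/6 of the partial sums over n³ is positive. The logarithms then
converge, so their limsup is their limit. -/
theorem operad_gkDim [Nontrivial M] : T.operad.gkDim = 3 := by
  unfold OperadData.gkDim
  simp only [finrank_operad]
  have hm : (0 : ℝ) < (Module.finrank k M : ℝ) / 6 := by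
    have : 0 < Module.finrank k M := Module.finrank_pos
    positivity
  exact (continuous_coe_real_ereal.continuousAt.tendsto.comp
    (tendsto_logb_of_tendsto_div_pow hm (tendsto_sum_div_pow _ _))).limsup_eq

theorem operad_genSeries : T.operad.genSeries =
    Ring.inverse (1 - PowerSeries.X)
      + (Module.finrank k T.bar : PowerSeries ℤ) * PowerSeries.X
        * Ring.inverse ((1 - PowerSeries.X) ^ 2)
      + (Module.finrank k M : PowerSeries ℤ) * PowerSeries.X ^ 2
        * Ring.inverse ((1 - PowerSeries.X) ^ 3) := by
  have h₀ := inverse_one_sub_pow 0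
  rw [zero_add, pow_one] at h₀
  rw [h₀, inverse_one_sub_pow 1, inverse_one_sub_pow 2]
  ext n
  simp only [OperadData.genSeries, finrank_operad, PowerSeries.coeff_mk, map_add, mul_assoc]
  rw [← map_natCast (PowerSeries.C (R := ℤ)), ← map_natCast (PowerSeries.C (R := ℤ)),
    PowerSeries.coeff_C_mul, PowerSeries.coeff_C_mul]
  -- The factors X and X² shift the binomial series by one and two places, so degrees 0 and 1 are
  -- separate.
  rcases n with _ | _ | n
  · simp
  · simp [PowerSeries.coeff_X_pow_mul', PowerSeries.coeff_succ_X_mul]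
  · rw [PowerSeries.coeff_X_pow_mul (d := n) (n := 2)]
    simp only [PowerSeries.coeff_succ_X_mul, PowerSeries.coeff_mk]
    rw [show 1 + (n + 1) = n + 1 + 1 by ring, show 2 + n = n + 1 + 1 by ring]
    push_cast
    simp
    ring

end Finite

end TridentSystem

end TridentOperad

open TridentOperad in
theorem theorem4p1 {k A M : Type*} [Field k] [Ring A] [Algebra k A] [Module.Finite k A]
    [AddCommGroup M] [Module k M] [Module.Finite k M] [Nontrivial M]
    [Module A M] [IsScalarTower k A M]
    [Module (A ⊗[k] A)ᵐᵒᵖ M] [IsScalarTower k (A ⊗[k] A)ᵐᵒᵖ M]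
    [SMulCommClass A (A ⊗[k] A)ᵐᵒᵖ M] (T : TridentSystem k A M) :
    T.operad.IsOperad ∧
    T.operad.IsTwoUnitary (T.unit 0) (T.unit 2) ∧
    (∃ u : OperadData.Hom (OperadData.com k) T.operad, ∀ n, u.app n (1 : k) = T.unit n) ∧
    T.operad.IsLocallyFinite ∧
    T.operad.gkDim = 3 ∧
    T.operad.genSeries =
      Ring.inverse (1 - PowerSeries.X)
        + (Module.finrank k T.bar : PowerSeries ℤ) * PowerSeries.X
          * Ring.inverse ((1 - PowerSeries.X) ^ 2)
        + (Module.finrank k M : PowerSeries ℤ) * PowerSeries.X ^ 2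
          * Ring.inverse ((1 - PowerSeries.X) ^ 3) :=
  ⟨T.operad_isOperad, T.operad_isTwoUnitary, ⟨T.comHom, T.comHom_one⟩, T.operad_isLocallyFinite,
    T.operad_gkDim, T.operad_genSeries⟩
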